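/- **Setting.** A *bigraph* is a triple $G=(V_1,V_2,E)$ with $V_1,V_2$ disjoint finite sets and $E\subseteq V_1\times V_2$; a *coloring* of $G$ is a function $c\colon E\to C$ to some set $C$. The pair $(G,c)$ is * *right-uniform* if there is $f\colon V_2\to C$ with $c(v,w)=f(w)$ for all $(v,w)\in E$; * *color-edge-transitive* if for all $(v_1,w_1),(v_2,w_2)\in E$ with $c(v_1,w_1)=c(v_2,w_2)$ there is an automorphism $\sigma$ of $(G,c)$ (a bijection of $V_1\cup V_2$ that preserves $V_1$, $V_2$, the edges, the non-edges, and the colors of the edges) with $\sigma(v_1)=v_2$ and $\sigma(w_1)=w_2$; * *left-weakly Hölder* if for every function $\ell\colon V_1\to C'$ to a set $C'$, all probability spaces $(X,\mu)$, $(Y,\nu)$ and every family $W=(W_i)_{i\in C'\times C}$ of bounded measurable functions $W_i\colon X\times Y\to[0,\infty)$, $$t((G,\ell\otimes c),W)\le\prod_{v\in V_1}t((G,\ell(v)\otimes c),W)^{1/|V_1|}.$$ Here $(\ell\otimes c)(v,w)=(\ell(v),c(v,w))$, on the right-hand side $\ell(v)$ stands for the constant function on $V_1$ with value $\ell(v)$,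 and for a coloring $c'\colon E\to C'\times C$, $$t((G,c'),W)=\int_{X^{V_1}\times Y^{V_2}}\ \prod_{(v,w)\in E}W_{c'(v,w)}(x_v,y_w)\ d(\mu^{V_1}\otimes\nu^{V_2})(x,y).$$ Let $R\subseteq \mathrm{GL}_n(\mathbb R)$ be a finite group generated by (orthogonal) reflections. Its *roots* are the unit vectors orthogonal to the fixed hyperplane of some reflection in $R$. Fix an ordered basis $(u_1,\dots,u_n)$ of $\mathbb R^n$; a root $\sum_i c_iu_i$ is *positive* if its first nonzero coefficient $c_i$ is positive. Let $\Delta$ be a simple system, i.e. an inclusion-minimal set of positive roots such that every positive root is a linear combination of elements of $\Delta$ with nonnegative coefficients, and let $S_\Delta=\{s_\alpha:\alpha\in\Delta\}$, where $s_\alpha$ is the reflection on the hyperplane orthogonal to $\alpha$. Let $k\in\mathbb N$, let $S_0,S_1,\dots,S_k\subseteq S_\Delta$, and let $R_i$ be the subgroup of $R$ generated by $S_i$. The *$(S_0;S_1,\dots,S_k;S_\Delta)$-left-reflection bigraph* $G$ is given by $$V_1(G)=R/R_0,\qquad V_2(G)=\bigsqcup_{i=1}^kR/R_i,\qquad E(G)=\{(rR_0,(rR_i,i))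 : r\in R,\ 1\le i\le k\},$$ where $R/R_i$ denotes the set of left cosets, and its *natural coloring* is $c\colon E(G)\to\{1,\dots,k\}$, $c(rR_0,(rR_i,i))=i$. **Theorem.** Let $G$ be a left-reflection bigraph and let $c$ be its natural coloring. Then $(G,c)$ is right-uniform, color-edge-transitive and left-weakly Hölder. -/

import Mathlib

open MeasureTheory

universe v₁ v₂ c' u x y

/-! ### Bigraphs and colorings -/

/-- A bigraph with left vertex set `V₁` and right vertex set `V₂`
(two separate types, so the two sides are automatically disjoint). -/
structure Bigraph (V₁ V₂ : Type*) where
  /-- the edge set `E ⊆ V₁ × V₂` -/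
  edges : Finset (V₁ × V₂)

namespace Bigraph

variable {V₁ V₂ C C' : Type*}

/-- A coloring of (the edges of) a bigraph; a pair `(G, c)` is a colored bigraph. -/
abbrev Coloring (G : Bigraph V₁ V₂) (C : Type*) := {e : V₁ × V₂ // e ∈ G.edges} → C

/-- `(G, c)` is right-uniform: `c(v, w) = f(w)` for some `f : V₂ → C`. -/
def RightUniform (G : Bigraph V₁ V₂) (c : G.Coloring C) : Prop :=
  ∃ f : V₂ → C, ∀ e : {e : V₁ × V₂ // e ∈ G.edges}, c e = f e.1.2

/-- The pair `(σ₁, σ₂)` of bijections of the left and of the right vertices is an automorphism of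
the colored bigraph `(G, c)`. -/
def IsColorAut (G : Bigraph V₁ V₂) (c : G.Coloring C)
    (σ₁ : Equiv.Perm V₁) (σ₂ : Equiv.Perm V₂) : Prop :=
  (∀ v w, (v, w) ∈ G.edges ↔ (σ₁ v, σ₂ w) ∈ G.edges) ∧
  ∀ (v : V₁) (w : V₂) (h : (v, w) ∈ G.edges) (h' : (σ₁ v, σ₂ w) ∈ G.edges),
    c ⟨(v, w), h⟩ = c ⟨(σ₁ v, σ₂ w), h'⟩

/-- `(G, c)` is color-edge-transitive: any two edges of the same color are related by an
automorphism of the colored bigraph. -/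
def ColorEdgeTransitive (G : Bigraph V₁ V₂) (c : G.Coloring C) : Prop :=
  ∀ e e' : {e : V₁ × V₂ // e ∈ G.edges}, c e = c e' →
    ∃ (σ₁ : Equiv.Perm V₁) (σ₂ : Equiv.Perm V₂),
      G.IsColorAut c σ₁ σ₂ ∧ σ₁ e.1.1 = e'.1.1 ∧ σ₂ e.1.2 = e'.1.2

/-- The coloring `ℓ ⊗ c`, for a left-coloring `ℓ : V₁ → C` and a coloring `c`. -/
def leftTensor (G : Bigraph V₁ V₂) (l : V₁ → C) (c : G.Coloring C') : G.Coloring (C × C') :=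
  fun e => (l e.1.1, c e)

end Bigraph

/-- A bigraphon: a bounded measurable function `W : X × Y → [0, ∞)`. -/
structure IsBigraphon {X Y : Type*} [MeasurableSpace X] [MeasurableSpace Y]
    (W : X × Y → ℝ) : Prop where
  measurable : Measurable W
  nonneg : ∀ p, 0 ≤ W p
  bounded : ∃ B : ℝ, ∀ p, W p ≤ B

namespace Bigraph

/-- The density
`t((G, c), W) = ∫_{X^{V₁} × Y^{V₂}} ∏_{(v,w) ∈ E(G)} W_{c(v,w)}(x_v, y_w) d(μ ⊗ ν)(x, y)`. -/
noncomputable def density {V₁ V₂ C X Y : Type*} [Fintype V₁] [Fintype V₂]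
    [MeasurableSpace X] [MeasurableSpace Y]
    (G : Bigraph V₁ V₂) (c : G.Coloring C) (μ : Measure X) (ν : Measure Y)
    (W : C → X × Y → ℝ) : ℝ :=
  ∫ p : (V₁ → X) × (V₂ → Y),
    ∏ e : {e : V₁ × V₂ // e ∈ G.edges}, W (c e) (p.1 e.1.1, p.2 e.1.2)
      ∂((Measure.pi fun _ : V₁ => μ).prod (Measure.pi fun _ : V₂ => ν))

/-- `(G, c)` is left-weakly Hölder: for every left-coloring `ℓ : V₁ → C` and every family of
bigraphons `(W_i)` indexed by `C × C'` over common probability spaces `(X, μ)`, `(Y, ν)`,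
`t((G, ℓ ⊗ c), W) ≤ ∏_{v ∈ V₁} t((G, ℓ(v) ⊗ c), W)^{1/|V₁|}`, where `ℓ(v)` on the right stands for
the constant left-coloring. -/
def LeftWeaklyHolder {V₁ : Type v₁} {V₂ : Type v₂} {C' : Type c'} [Fintype V₁] [Fintype V₂]
    (G : Bigraph V₁ V₂) (c : G.Coloring C') : Prop :=
  ∀ (C : Type u) (l : V₁ → C)
    (X : Type x) (Y : Type y) [MeasurableSpace X] [MeasurableSpace Y]
    (μ : Measure X) (ν : Measure Y) [IsProbabilityMeasure μ] [IsProbabilityMeasure ν]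
    (W : C × C' → X × Y → ℝ), (∀ i, IsBigraphon (W i)) →
    G.density (G.leftTensor l c) μ ν W ≤
      ∏ v : V₁, G.density (G.leftTensor (fun _ => l v) c) μ ν W ^ (1 / (Fintype.card V₁ : ℝ))

end Bigraph

/-! ### Finite reflection groups -/

namespace ReflectionGroup

/-- Euclidean space `ℝⁿ`. -/
abbrev Euc (n : ℕ) := EuclideanSpace ℝ (Fin n)

/-- `GL_n(ℝ)`, as the group of linear automorphisms of `ℝⁿ`. -/
abbrev GLn (n : ℕ) := Euc n ≃ₗ[ℝ] Euc n

variable {n : ℕ}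

/-- The (orthogonal) reflection `s_α` on the hyperplane `H_α` orthogonal to `α`. -/
noncomputable def hyperplaneReflection (α : Euc n) : GLn n :=
  ((Submodule.span ℝ {α})ᗮ.reflection).toLinearEquiv

/-- The set `T` of reflections in `R`. -/
def reflections (R : Subgroup (GLn n)) : Set (GLn n) :=
  {t | t ∈ R ∧ ∃ α : Euc n, α ≠ 0 ∧ t = hyperplaneReflection α}

/-- `R` is a reflection group, i.e. generated by its reflections. -/
def IsReflectionGroup (R : Subgroup (GLn n)) : Prop :=
  Subgroup.closure (reflections R) = R

/-- The root system of `R`: the unit vectors orthogonal to the hyperplane fixed by some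
reflection in `R`. -/
def roots (R : Subgroup (GLn n)) : Set (Euc n) :=
  {α | ‖α‖ = 1 ∧ ∃ t ∈ reflections R, ∀ x : Euc n, t x = x ↔ inner ℝ α x = 0}

/-- The positive roots with respect to an ordered basis `u`: those whose first nonzero coordinate
with respect to `u` is positive. -/
def positiveRoots (R : Subgroup (GLn n)) (u : Module.Basis (Fin n) ℝ (Euc n)) : Set (Euc n) :=
  {α | α ∈ roots R ∧ ∃ i, 0 < u.repr α i ∧ ∀ j < i, u.repr α j = 0}

/-- `Δ` is a simple system: it is a minimal set of positive roots such that every positive root is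
a linear combination with nonnegative coefficients of elements of `Δ`. -/
def IsSimpleSystem (R : Subgroup (GLn n)) (u : Module.Basis (Fin n) ℝ (Euc n))
    (Δ : Set (Euc n)) : Prop :=
  Minimal (fun D : Set (Euc n) => D ⊆ positiveRoots R u ∧
    ∀ α ∈ positiveRoots R u, α ∈ PointedCone.hull ℝ D) Δ

/-- The set `S_Δ` of simple reflections, as elements of `R`. -/
def simpleReflections (R : Subgroup (GLn n)) (Δ : Set (Euc n)) : Set R :=
  {s | ∃ α ∈ Δ, (s : GLn n) = hyperplaneReflection α}

end ReflectionGroup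

/-! ### Left-reflection bigraphs -/

section LeftReflection

variable {R : Type*} [Group R] {k : ℕ}

/-- The left vertices of the left-reflection bigraph: the left cosets of the subgroup `R₀`
generated by `S₀`. -/
abbrev LeftVertex (S₀ : Set R) := R ⧸ Subgroup.closure S₀

/-- The right vertices of the left-reflection bigraph: the disjoint union over `i` of the left
cosets of the subgroups `R_i` generated by `S_i`. -/
abbrev RightVertex (S : Fin k → Set R) := Σ i : Fin k, R ⧸ Subgroup.closure (S i)

noncomputable instance cosetFintype [Finite R] (H : Subgroup R) : Fintype (R ⧸ H) :=
  Fintype.ofFinite _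

/-- The `(S₀; S₁, …, S_k)`-left-reflection bigraph, with edges `(r R₀, (r R_i, i))` for `r ∈ R` and
`i` in the index set. -/
noncomputable def leftReflectionBigraph [Finite R] (S₀ : Set R) (S : Fin k → Set R) :
    Bigraph (LeftVertex S₀) (RightVertex S) where
  edges := (Set.toFinite {e : LeftVertex S₀ × RightVertex S |
    ∃ (r : R) (i : Fin k), e = (QuotientGroup.mk r, ⟨i, QuotientGroup.mk r⟩)}).toFinset

/-- The natural coloring: the edge `(r R₀, (r R_i, i))` gets color `i`. -/
noncomputable def naturalColoring [Finite R] (S₀ : Set R) (S : Fin k → Set R) :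
    (leftReflectionBigraph S₀ S).Coloring (Fin k) :=
  fun e => e.1.2.1

end LeftReflection

/-! ### Positive roots of a finite reflection group -/

namespace ReflectionGroup

variable {n : ℕ}

/-! The color of an edge is the index of its right end, and `R` acts by left multiplication, with
`r' * r⁻¹` moving the edge of `r` to that of `r'`. This settles right-uniformity and transitivity;
the Hölder inequality is the real content.

Let `s` be a simple reflection with root `α`. A coset `rH` that `s` moves has a side, given by the
sign of the root `r⁻¹ α`; this does not depend on `r` (`parabolic_map_mem_positiveRoots`). The two
ends of an edge share a representative `r`, so no edge joins opposite sides. Given the variables at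
the fixed vertices, the two halves of the integrand are therefore independent mirror images, and
Cauchy–Schwarz bounds the squared density by the product of the densities for the labelings folded
onto either side (`IsFold.sq_density_le`).

In `le_prod_rpow_of_folds` these inequalities are combined by a maximum argument. Over the finitely
many self-maps `f` of the left side, the ratio of the density for `ℓ ∘ f` to the corresponding
Hölder product is maximized. Folding keeps a maximizer maximal, and suitable successive folds make
it constant, where the ratio is 1. Such folds exist because folding toward the base coset never
increases minimal word length, and some fold shortens any other given coset; this rests on the
exchange property. -/

lemma hyperplaneReflection_apply {α : Euc n} (hα : ‖α‖ = 1) (x : Euc n) :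
    hyperplaneReflection α x = x - (2 * inner ℝ α x) • α := by
  have : hyperplaneReflection α x = (Submodule.span ℝ {α})ᗮ.reflection x := rfl
  rw [this, Submodule.reflection_orthogonal_apply, Submodule.reflection_singleton_apply, hα]
  simp only [RCLike.ofReal_real_eq_id, id, one_pow, div_one, two_smul]
  module

lemma hyperplaneReflection_congr {α β : Euc n}
    (h : Submodule.span ℝ {α} = Submodule.span ℝ {β}) :
    hyperplaneReflection α = hyperplaneReflection β := by
  simp only [hyperplaneReflection, h]

lemma hyperplaneReflection_smul {a : ℝ} (ha : a ≠ 0) (α : Euc n) :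
    hyperplaneReflection (a • α) = hyperplaneReflection α := by
  exact hyperplaneReflection_congr (Submodule.span_singleton_smul_eq (isUnit_iff_ne_zero.2 ha) α)

lemma hyperplaneReflection_neg (α : Euc n) :
    hyperplaneReflection (-α) = hyperplaneReflection α := by
  simpa using hyperplaneReflection_smul (a := -1) (by norm_num) α

lemma hyperplaneReflection_mul_self (α : Euc n) :
    hyperplaneReflection α * hyperplaneReflection α = 1 := by
  refine LinearEquiv.ext fun x => ?_
  rw [LinearEquiv.mul_apply]
  exact Submodule.reflection_reflection (Submodule.span ℝ {α})ᗮ x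

lemma hyperplaneReflection_self (α : Euc n) : hyperplaneReflection α α = -α :=
  Submodule.reflection_orthogonalComplement_singleton_eq_neg α

lemma norm_hyperplaneReflection (α x : Euc n) : ‖hyperplaneReflection α x‖ = ‖x‖ :=
  LinearIsometryEquiv.norm_map (Submodule.span ℝ {α})ᗮ.reflection x

/-- `r` preserves norms. -/
def IsOrth (r : GLn n) : Prop := ∀ x, ‖r x‖ = ‖x‖

lemma IsOrth.inner_map {r : GLn n} (h : IsOrth r) (x y : Euc n) :
    inner ℝ (r x) (r y) = inner ℝ x y :=
  (LinearIsometry.inner_map_map (⟨r.toLinearMap, h⟩ : Euc n →ₗᵢ[ℝ] Euc n) x y)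

lemma isOrth_of_mem {R : Subgroup (GLn n)} (hR : IsReflectionGroup R) {r : GLn n} (hr : r ∈ R) :
    IsOrth r := by
  rw [← hR] at hr
  induction hr using Subgroup.closure_induction with
  | mem t ht =>
    obtain ⟨-, α, -, rfl⟩ := ht
    exact norm_hyperplaneReflection α
  | one => exact fun _ => rfl
  | mul x y _ _ hx hy => exact fun v => (hx (y v)).trans (hy v)
  | inv x _ hx =>
    intro v
    have := hx (x⁻¹ v)
    rwa [← LinearEquiv.mul_apply, mul_inv_cancel, LinearEquiv.coe_one, id, eq_comm] at this

lemma conj_hyperplaneReflection {r : GLn n} (h : IsOrth r) {α : Euc n} (hα : ‖α‖ = 1) :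
    r * hyperplaneReflection α * r⁻¹ = hyperplaneReflection (r α) := by
  rw [mul_inv_eq_iff_eq_mul]
  ext1 x
  rw [LinearEquiv.mul_apply, LinearEquiv.mul_apply, hyperplaneReflection_apply hα,
    hyperplaneReflection_apply ((h α).trans hα), h.inner_map, map_sub, map_smul]

/-- A reflection is determined by its fixed hyperplane: taking orthogonal complements twice recovers
the line of the root. -/
lemma mem_roots_iff {R : Subgroup (GLn n)} {α : Euc n} :
    α ∈ roots R ↔ ‖α‖ = 1 ∧ hyperplaneReflection α ∈ R := by
  constructor
  · rintro ⟨h1, t, ⟨htR, β, hβ, rfl⟩, h⟩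
    refine ⟨h1, ?_⟩
    suffices h' : (Submodule.span ℝ {α}) = Submodule.span ℝ {β} by
      rwa [hyperplaneReflection_congr h']
    rw [← Submodule.orthogonal_orthogonal (Submodule.span ℝ {α}),
      ← Submodule.orthogonal_orthogonal (Submodule.span ℝ {β})]
    congr 1
    ext x
    rw [Submodule.mem_orthogonal_singleton_iff_inner_right, ← h x]
    exact Submodule.reflection_eq_self_iff x
  · rintro ⟨h1, h⟩
    have h0 : α ≠ 0 := by rintro rfl; simp at h1
    refine ⟨h1, _, ⟨h, α, h0, rfl⟩, fun x => ?_⟩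
    rw [← Submodule.mem_orthogonal_singleton_iff_inner_right]
    exact Submodule.reflection_eq_self_iff x

lemma map_mem_roots {R : Subgroup (GLn n)} (hR : IsReflectionGroup R) {r : GLn n} (hr : r ∈ R)
    {α : Euc n} (hα : α ∈ roots R) : r α ∈ roots R := by
  rw [mem_roots_iff] at *
  have h := isOrth_of_mem hR hr
  refine ⟨(h α).trans hα.1, ?_⟩
  rw [← conj_hyperplaneReflection h hα.1]
  exact R.mul_mem (R.mul_mem hr hα.2) (R.inv_mem hr)

/-- The vectors whose first nonzero coordinate in the ordered basis `b` is positive. -/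
def LexPos (b : Module.Basis (Fin n) ℝ (Euc n)) (x : Euc n) : Prop :=
  ∃ i, 0 < b.repr x i ∧ ∀ j < i, b.repr x j = 0

/-! ### Lexicographic positivity -/

section LexPos

variable {b : Module.Basis (Fin n) ℝ (Euc n)} {x y : Euc n}

lemma LexPos.add (hx : LexPos b x) (hy : LexPos b y) : LexPos b (x + y) := by
  obtain ⟨i, hi, hi'⟩ := hx
  obtain ⟨j, hj, hj'⟩ := hy
  rcases lt_trichotomy i j with h | rfl | h
  · exact ⟨i, by simpa [hj' i h] using hi, fun k hk => by simp [hi' k hk, hj' k (hk.trans h)]⟩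
  · exact ⟨i, by simpa using add_pos hi hj, fun k hk => by simp [hi' k hk, hj' k hk]⟩
  · exact ⟨j, by simpa [hi' j h] using hj, fun k hk => by simp [hj' k hk, hi' k (hk.trans h)]⟩

lemma LexPos.smul {a : ℝ} (ha : 0 < a) (hx : LexPos b x) : LexPos b (a • x) := by
  obtain ⟨i, hi, hi'⟩ := hx
  exact ⟨i, by simpa using mul_pos ha hi, fun k hk => by simp [hi' k hk]⟩

lemma not_lexPos_zero : ¬ LexPos b 0 := by
  rintro ⟨i, hi, -⟩
  simp at hi

lemma LexPos.not_neg (hx : LexPos b x) : ¬ LexPos b (-x) := fun h => by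
  have := hx.add h
  rw [add_neg_cancel] at this
  exact not_lexPos_zero this

lemma lexPos_or_neg (hx : x ≠ 0) : LexPos b x ∨ LexPos b (-x) := by
  have : ∃ i, b.repr x i ≠ 0 := by
    by_contra! h
    exact hx (b.repr.map_eq_zero_iff.1 (Finsupp.ext h))
  obtain ⟨i, hi, hmin⟩ := WellFounded.has_min (wellFounded_lt (α := Fin n))
    {i | b.repr x i ≠ 0} this
  have h0 : ∀ j < i, b.repr x j = 0 := fun j hj => by
    by_contra h
    exact hmin j h hj
  rcases lt_or_gt_of_ne hi with h | h
  · exact Or.inr ⟨i, by simpa using h, fun j hj => by simpa using h0 j hj⟩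
  · exact Or.inl ⟨i, h, h0⟩

/-- Lexicographic positivity survives sums and positive scaling, so a cone spanned by positive
vectors never contains a nonzero vector together with its negative. -/
lemma eq_zero_or_lexPos_of_mem_hull {D : Set (Euc n)} (hD : ∀ d ∈ D, LexPos b d)
    (hx : x ∈ PointedCone.hull ℝ D) : x = 0 ∨ LexPos b x := by
  induction hx using Submodule.span_induction with
  | mem x h => exact Or.inr (hD x h)
  | zero => exact Or.inl rfl
  | add x y _ _ hx hy =>
    rcases hx with rfl | hx
    · simpa using hy
    rcases hy with rfl | hy
    · simpa using Or.inr hx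
    · exact Or.inr (hx.add hy)
  | smul a x _ hx =>
    rcases hx with rfl | hx
    · simp
    rcases eq_or_ne a 0 with rfl | ha
    · simp
    · exact Or.inr (hx.smul (a := (a : ℝ)) (NNReal.coe_pos.2 (pos_iff_ne_zero.2 ha)))

end LexPos

/-! ### Simple systems and generation by simple reflections -/

variable {R : Subgroup (GLn n)} {b : Module.Basis (Fin n) ℝ (Euc n)} {Δ : Set (Euc n)}

lemma ne_zero_of_mem_roots {α : Euc n} (h : α ∈ roots R) : α ≠ 0 := by
  rintro rfl
  simpa using h.1

lemma neg_mem_roots {α : Euc n} (h : α ∈ roots R) : -α ∈ roots R := by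
  rw [mem_roots_iff] at *
  rwa [norm_neg, hyperplaneReflection_neg]

lemma pos_or_neg_of_mem_roots {α : Euc n} (h : α ∈ roots R) :
    α ∈ positiveRoots R b ∨ -α ∈ positiveRoots R b := by
  rcases lexPos_or_neg (b := b) (ne_zero_of_mem_roots h) with h' | h'
  · exact Or.inl ⟨h, h'⟩
  · exact Or.inr ⟨neg_mem_roots h, h'⟩

lemma neg_notMem_positiveRoots {α : Euc n} (h : α ∈ positiveRoots R b) :
    -α ∉ positiveRoots R b := fun h' => LexPos.not_neg h.2 h'.2

lemma norm_of_mem {α : Euc n} (h : α ∈ positiveRoots R b) : ‖α‖ = 1 := h.1.1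

/-- A simple reflection permutes the positive roots other than its own. -/
lemma simple_map_mem_positiveRoots (hR : IsReflectionGroup R) (hΔ : IsSimpleSystem R b Δ)
    {α β : Euc n} (hα : α ∈ Δ) (hβ : β ∈ positiveRoots R b) (hne : β ≠ α) :
    hyperplaneReflection α β ∈ positiveRoots R b := by
  obtain ⟨⟨hsub, hgen⟩, hmin⟩ := hΔ
  have hαp := hsub hα
  have hαR := (mem_roots_iff.1 hαp.1).2
  refine (pos_or_neg_of_mem_roots (map_mem_roots hR hαR hβ.1)).resolve_right fun hneg => ?_
  have hins : insert α (Δ \ {α}) = Δ := by simp [Set.insert_eq_of_mem hα]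
  have hlex : ∀ d ∈ Δ \ {α}, LexPos b d := fun d hd => (hsub hd.1).2
  have decomp : ∀ γ ∈ positiveRoots R b, ∃ (a : NNReal), ∃ y ∈ PointedCone.hull ℝ (Δ \ {α}),
      γ = a • α + y := by
    intro γ hγ
    have := hgen γ hγ
    rw [← hins, PointedCone.hull, Submodule.mem_span_insert] at this
    exact this
  obtain ⟨a, y, hy, hβe⟩ := decomp β hβ
  obtain ⟨a', y', hy', hβe'⟩ := decomp _ hneg
  rw [hyperplaneReflection_apply (norm_of_mem hαp)] at hβe'
  have hya : ∀ z : Euc n, (a • z : Euc n) = (a : ℝ) • z := fun _ => rfl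
  have hya' : ∀ z : Euc n, (a' • z : Euc n) = (a' : ℝ) • z := fun _ => rfl
  rw [hya] at hβe
  rw [hya'] at hβe'
  -- If `y = 0`, then `β` is a nonnegative multiple of `α`, and both are unit vectors, so `β = α`.
  have hypos : LexPos b y := by
    refine (eq_zero_or_lexPos_of_mem_hull hlex hy).resolve_left ?_
    rintro rfl
    have h1 := norm_of_mem hβ
    rw [hβe, add_zero, norm_smul, norm_of_mem hαp, mul_one, Real.norm_of_nonneg (NNReal.coe_nonneg a)] at h1
    exact hne (by rw [hβe, h1, one_smul, add_zero])
  -- Adding the expansions of `β` and of `-s_α β` cancels `β` and leaves a multiple of `α`.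
  have hsum : y + y' = (2 * inner ℝ α β - a - a') • α := by
    have h1 : y = β - (a : ℝ) • α := by rw [hβe]; module
    have h2 : y' = -(β - (2 * inner ℝ α β) • α) - (a' : ℝ) • α := by rw [hβe']; module
    rw [h1, h2]
    module
  have hpos : LexPos b (y + y') := by
    rcases eq_zero_or_lexPos_of_mem_hull hlex hy' with rfl | h
    · rwa [add_zero]
    · exact hypos.add h
  set e := 2 * inner ℝ α β - a - a' with he
  -- For `e ≤ 0` the positive vector `y + y'` would be zero or negative; for `e > 0` the root `α`
  -- lies in the cone of the other simple roots, against the minimality of `Δ`.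
  rcases lt_trichotomy e 0 with h | h | h
  · refine hpos.not_neg ?_
    rw [hsum, ← neg_smul]
    exact LexPos.smul (neg_pos.2 h) hαp.2
  · rw [hsum, h, zero_smul] at hpos
    exact not_lexPos_zero hpos
  · have hmem : α ∈ PointedCone.hull ℝ (Δ \ {α}) := by
      have h3 : α = (⟨e⁻¹, (inv_pos.2 h).le⟩ : NNReal) • (y + y') := by
        rw [hsum]
        change α = e⁻¹ • e • α
        rw [smul_smul, inv_mul_cancel₀ h.ne', one_smul]
      exact (congrArg (· ∈ PointedCone.hull ℝ (Δ \ {α})) h3).mpr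
        (Submodule.smul_mem _ _ (Submodule.add_mem _ hy hy'))
    have hle : Δ ⊆ Δ \ {α} := hmin (y := Δ \ {α})
      ⟨Set.sdiff_subset.trans hsub, fun γ hγ => by
        have := hgen γ hγ
        rw [← hins] at this
        refine Submodule.span_le.2 ?_ this
        rintro d (rfl | hd)
        · exact hmem
        · exact Submodule.subset_span hd⟩ Set.sdiff_subset
    exact (hle hα).2 rfl

/-- A positive root makes an acute angle with some simple root. -/
lemma exists_simple_inner_pos (hΔ : IsSimpleSystem R b Δ) {γ : Euc n}
    (hγ : γ ∈ positiveRoots R b) : ∃ α ∈ Δ, 0 < inner ℝ α γ := by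
  by_contra! h
  have : ∀ x ∈ PointedCone.hull ℝ Δ, inner ℝ x γ ≤ 0 := by
    intro x hx
    induction hx using Submodule.span_induction with
    | mem x hx => exact h x hx
    | zero => simp
    | add x y _ _ hx hy => rw [inner_add_left]; exact add_nonpos hx hy
    | smul a x _ hx =>
      change inner ℝ ((a : ℝ) • x) γ ≤ 0
      rw [real_inner_smul_left]
      exact mul_nonpos_of_nonneg_of_nonpos a.2 hx
  have h1 := this γ (hΔ.1.2 γ hγ)
  rw [real_inner_self_eq_norm_sq, norm_of_mem hγ] at h1
  norm_num at h1

/-- From `s_β α = -α` it follows that `α` is a multiple of `β`; the norms leave only a sign, and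
positivity fixes it. -/
lemma eq_of_hyperplaneReflection_eq {α β : Euc n} (hα : α ∈ positiveRoots R b)
    (hβ : β ∈ positiveRoots R b) (h : hyperplaneReflection α = hyperplaneReflection β) :
    α = β := by
  have h1 := hyperplaneReflection_self α
  rw [h, hyperplaneReflection_apply (norm_of_mem hβ)] at h1
  have h2 : α = inner ℝ β α • β := by
    have : (2 : ℝ) • α = (2 : ℝ) • (inner ℝ β α • β) := by
      rw [smul_smul, ← sub_eq_zero, two_smul]
      rw [← sub_eq_zero] at h1
      rw [← h1]; abel
    exact smul_right_injective _ (two_ne_zero (α := ℝ)) this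
  set c : ℝ := inner ℝ β α
  have h3 := norm_of_mem hα
  rw [h2, norm_smul, norm_of_mem hβ, mul_one, Real.norm_eq_abs] at h3
  rcases eq_or_eq_neg_of_abs_eq h3 with h4 | h4
  · rw [h2, h4, one_smul]
  · rw [h4, neg_one_smul] at h2
    exact absurd (h2 ▸ hα) (neg_notMem_positiveRoots hβ)

lemma finite_positiveRoots [Finite R] : (positiveRoots R b).Finite := by
  have : Set.InjOn hyperplaneReflection (positiveRoots R b) := fun α hα β hβ h =>
    eq_of_hyperplaneReflection_eq hα hβ h
  refine Set.Finite.of_finite_image ((Set.toFinite (R : Set (GLn n))).subset ?_) this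
  rintro _ ⟨α, hα, rfl⟩
  exact (mem_roots_iff.1 hα.1).2

/-- Every positive root reflection is a product of simple reflections. -/
lemma hyperplaneReflection_mem_closure [Finite R] (hR : IsReflectionGroup R)
    (hΔ : IsSimpleSystem R b Δ) {β : Euc n} (hβ : β ∈ positiveRoots R b) :
    hyperplaneReflection β ∈ Subgroup.closure (hyperplaneReflection '' Δ) := by
  have : Finite (positiveRoots R b) := finite_positiveRoots
  -- The induction is along the lexicographic order, which is well-founded because there are only
  -- finitely many positive roots.
  let lt : positiveRoots R b → positiveRoots R b → Prop := fun x y => LexPos b (y.1 - x.1)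
  have : IsTrans _ lt := ⟨fun x y z h h' => by
    simp only [lt] at *
    convert h'.add h using 1
    abel⟩
  have : Std.Irrefl lt := ⟨fun x h => not_lexPos_zero (b := b) (by simpa [lt] using h)⟩
  have wf : WellFounded lt := Finite.wellFounded_of_trans_of_irrefl lt
  suffices h : ∀ β : positiveRoots R b,
      hyperplaneReflection β.1 ∈ Subgroup.closure (hyperplaneReflection '' Δ) from h ⟨β, hβ⟩
  intro β
  induction β using wf.induction with
  | _ β ih =>
    obtain ⟨β, hβ⟩ := β
    by_cases hd : β ∈ Δ
    · exact Subgroup.subset_closure ⟨β, hd, rfl⟩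
    -- Reflecting in this `α` subtracts a positive multiple of `α`, so the new positive root is
    -- strictly smaller; conjugating its reflection by `s_α` gives `s_β` back.
    obtain ⟨α, hα, hpos⟩ := exists_simple_inner_pos hΔ hβ
    have hαp := hΔ.1.1 hα
    have hβ' := simple_map_mem_positiveRoots hR hΔ hα hβ (by rintro rfl; exact hd hα)
    have h1 := ih ⟨_, hβ'⟩ (by
      simp only [lt]
      rw [hyperplaneReflection_apply (norm_of_mem hαp), sub_sub_cancel]
      exact LexPos.smul (by positivity) hαp.2)
    have hs : hyperplaneReflection α ∈ Subgroup.closure (hyperplaneReflection '' Δ) :=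
      Subgroup.subset_closure ⟨α, hα, rfl⟩
    rw [← conj_hyperplaneReflection (norm_hyperplaneReflection α) (norm_of_mem hβ)] at h1
    have h2 := mul_mem (mul_mem (inv_mem hs) h1) hs
    simpa [mul_assoc] using h2

/-- The simple reflections generate the group. -/
theorem closure_simpleReflections [Finite R] (hR : IsReflectionGroup R)
    (hΔ : IsSimpleSystem R b Δ) : Subgroup.closure (simpleReflections R Δ) = ⊤ := by
  have himage : R.subtype '' simpleReflections R Δ = hyperplaneReflection '' Δ := by
    ext t
    constructor
    · rintro ⟨s, ⟨α, hα, hs⟩, rfl⟩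
      exact ⟨α, hα, hs.symm⟩
    · rintro ⟨α, hα, rfl⟩
      exact ⟨⟨_, (mem_roots_iff.1 (hΔ.1.1 hα).1).2⟩, ⟨α, hα, rfl⟩, rfl⟩
  have hle : R ≤ (Subgroup.closure (simpleReflections R Δ)).map R.subtype := by
    rw [MonoidHom.map_closure, himage]
    conv_lhs => rw [← hR]
    rw [Subgroup.closure_le]
    rintro _ ⟨ht, α, h0, rfl⟩
    have hn : ‖α‖⁻¹ ≠ 0 := inv_ne_zero (norm_ne_zero_iff.2 h0)
    have hroot : ‖α‖⁻¹ • α ∈ roots R := by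
      rw [mem_roots_iff, hyperplaneReflection_smul hn]
      exact ⟨by rw [norm_smul, norm_inv, norm_norm, inv_mul_cancel₀ (norm_ne_zero_iff.2 h0)], ht⟩
    rw [SetLike.mem_coe, ← hyperplaneReflection_smul hn]
    rcases pos_or_neg_of_mem_roots (b := b) hroot with h | h
    · exact hyperplaneReflection_mem_closure hR hΔ h
    · rw [← hyperplaneReflection_neg]
      exact hyperplaneReflection_mem_closure hR hΔ h
  rw [eq_top_iff]
  intro r _
  obtain ⟨r', hr', h⟩ := hle r.2
  rwa [← Subtype.ext h]

end ReflectionGroup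

/-! ### Reflection positivity -/

section ReflectionPositivity

variable {α β : Type*} [MeasurableSpace α] [MeasurableSpace β]

/-- The bilinear form `∫ h(a) f(a, b) g(a, b')` is positive semidefinite. -/
lemma integral_mul_mul_self_nonneg {μ : Measure α} {ν : Measure β} [IsProbabilityMeasure μ]
    [IsProbabilityMeasure ν] {h : α → ℝ} {f : α × β → ℝ}
    (h0 : ∀ a, 0 ≤ h a)
    (hint : Integrable (fun p : α × (β × β) => h p.1 * (f (p.1, p.2.1) * f (p.1, p.2.2)))
      (μ.prod (ν.prod ν))) :
    0 ≤ ∫ p : α × (β × β), h p.1 * (f (p.1, p.2.1) * f (p.1, p.2.2)) ∂(μ.prod (ν.prod ν)) := by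
  rw [integral_prod _ hint]
  refine integral_nonneg fun a => ?_
  simp only [Pi.zero_apply]
  -- For fixed `a` the variables `b`, `b'` are independent, so the inner integral is a square.
  rw [integral_const_mul, integral_prod_mul (fun b => f (a, b)) (fun b => f (a, b))]
  exact mul_nonneg (h0 a) (mul_self_nonneg _)

lemma integrable_of_bounded {μ : Measure α} [IsProbabilityMeasure μ] {f : α → ℝ}
    (hf : Measurable f) (hb : ∃ B : ℝ, ∀ x, |f x| ≤ B) : Integrable f μ := by
  obtain ⟨B, hB⟩ := hb
  exact Integrable.of_bound hf.aestronglyMeasurable B (Filter.Eventually.of_forall hB)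

/-- Cauchy–Schwarz for the form `∫ h(a) f(a, b) g(a, b')`. -/
lemma integral_mul_mul_sq_le {μ : Measure α} {ν : Measure β} [IsProbabilityMeasure μ]
    [IsProbabilityMeasure ν] {h : α → ℝ} {f g : α × β → ℝ}
    (hm : Measurable h) (fm : Measurable f) (gm : Measurable g)
    (hb : ∃ B : ℝ, ∀ x, |h x| ≤ B) (fb : ∃ B : ℝ, ∀ x, |f x| ≤ B) (gb : ∃ B : ℝ, ∀ x, |g x| ≤ B)
    (h0 : ∀ a, 0 ≤ h a) :
    (∫ p : α × (β × β), h p.1 * (f (p.1, p.2.1) * g (p.1, p.2.2)) ∂(μ.prod (ν.prod ν))) ^ 2 ≤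
      (∫ p : α × (β × β), h p.1 * (f (p.1, p.2.1) * f (p.1, p.2.2)) ∂(μ.prod (ν.prod ν))) *
      ∫ p : α × (β × β), h p.1 * (g (p.1, p.2.1) * g (p.1, p.2.2)) ∂(μ.prod (ν.prod ν)) := by
  have key : ∀ {f g : α × β → ℝ}, Measurable f → Measurable g → (∃ B : ℝ, ∀ x, |f x| ≤ B) →
      (∃ B : ℝ, ∀ x, |g x| ≤ B) →
      Integrable (fun p : α × (β × β) => h p.1 * (f (p.1, p.2.1) * g (p.1, p.2.2)))
        (μ.prod (ν.prod ν)) := by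
    intro f g fm gm ⟨F, hF⟩ ⟨G, hG⟩
    obtain ⟨H, hH⟩ := hb
    refine integrable_of_bounded (by fun_prop) ⟨H * (F * G), fun p => ?_⟩
    rw [abs_mul, abs_mul]
    have := (abs_nonneg _).trans (hF (p.1, p.2.1))
    have := (abs_nonneg _).trans (hH p.1)
    gcongr
    · exact hH _
    · exact hF _
    · exact hG _
  have symm : ∫ p : α × (β × β), h p.1 * (g (p.1, p.2.1) * f (p.1, p.2.2)) ∂(μ.prod (ν.prod ν)) =
      ∫ p : α × (β × β), h p.1 * (f (p.1, p.2.1) * g (p.1, p.2.2)) ∂(μ.prod (ν.prod ν)) := by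
    rw [integral_prod _ (key gm fm gb fb), integral_prod _ (key fm gm fb gb)]
    refine integral_congr_ae (Filter.Eventually.of_forall fun a => ?_)
    simp only
    rw [integral_const_mul, integral_const_mul,
      integral_prod_mul (fun b => g (a, b)) (fun b => f (a, b)),
      integral_prod_mul (fun b => f (a, b)) (fun b => g (a, b)), mul_comm (∫ b, g (a, b) ∂ν)]
  -- This is the form evaluated at `f + t g`; its discriminant gives Cauchy–Schwarz.
  have quad : ∀ t : ℝ,
      0 ≤ (∫ p : α × (β × β), h p.1 * (g (p.1, p.2.1) * g (p.1, p.2.2)) ∂(μ.prod (ν.prod ν)))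
          * (t * t) +
        2 * (∫ p : α × (β × β), h p.1 * (f (p.1, p.2.1) * g (p.1, p.2.2)) ∂(μ.prod (ν.prod ν)))
          * t +
        ∫ p : α × (β × β), h p.1 * (f (p.1, p.2.1) * f (p.1, p.2.2)) ∂(μ.prod (ν.prod ν)) := by
    intro t
    obtain ⟨F, hF⟩ := fb
    obtain ⟨G, hG⟩ := gb
    have hk : Measurable fun x => f x + t * g x := by fun_prop
    have hkb : ∃ B : ℝ, ∀ x, |f x + t * g x| ≤ B := by
      refine ⟨F + |t| * G, fun x => (abs_add_le _ _).trans ?_⟩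
      rw [abs_mul]
      gcongr
      · exact hF x
      · exact hG x
    have := integral_mul_mul_self_nonneg h0 (key hk hk hkb hkb)
    refine this.trans_eq ?_
    let K : (α × β → ℝ) → (α × β → ℝ) → α × (β × β) → ℝ :=
      fun f g p => h p.1 * (f (p.1, p.2.1) * g (p.1, p.2.2))
    have e : K (fun x => f x + t * g x) (fun x => f x + t * g x) =
        ((K f f + t • K f g) + t • K g f) + (t * t) • K g g := by
      funext p
      simp only [K, Pi.add_apply, Pi.smul_apply, smul_eq_mul]
      ring
    have iff : Integrable (K f f) (μ.prod (ν.prod ν)) := key fm fm ⟨F, hF⟩ ⟨F, hF⟩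
    have ifg : Integrable (t • K f g) (μ.prod (ν.prod ν)) := (key fm gm ⟨F, hF⟩ ⟨G, hG⟩).smul t
    have igf : Integrable (t • K g f) (μ.prod (ν.prod ν)) := (key gm fm ⟨G, hG⟩ ⟨F, hF⟩).smul t
    have igg : Integrable ((t * t) • K g g) (μ.prod (ν.prod ν)) :=
      (key gm gm ⟨G, hG⟩ ⟨G, hG⟩).smul (t * t)
    change ∫ p, K (fun x => f x + t * g x) (fun x => f x + t * g x) p ∂_ = _
    rw [e, integral_add' ((iff.add ifg).add igf) igg, integral_add' (iff.add ifg) igf,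
      integral_add' iff ifg]
    simp only [Pi.smul_apply, smul_eq_mul, integral_const_mul, K, symm]
    ring
  have := discrim_le_zero quad
  rw [discrim] at this
  nlinarith

/-- Reflection positivity: if a probability measure `P` is obtained by gluing two conditionally
independent halves that are exchanged by `τ`, then `∫ h · f · (g ∘ τ)` satisfies Cauchy–Schwarz
for functions `f`, `g` of the first half. -/
lemma sq_integral_mul_comp_le {Ω : Type*} [MeasurableSpace Ω] {P : Measure Ω}
    {μ : Measure α} {ν : Measure β} [IsProbabilityMeasure μ] [IsProbabilityMeasure ν]
    {M : α × (β × β) → Ω} (hM : MeasurePreserving M (μ.prod (ν.prod ν)) P) [Nonempty β]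
    {τ : Ω → Ω} (hτ : Measurable τ) (hMτ : ∀ a b b', τ (M (a, b, b')) = M (a, b', b))
    {h f g : Ω → ℝ} (hm : Measurable h) (fm : Measurable f) (gm : Measurable g)
    (hb : ∃ B : ℝ, ∀ x, |h x| ≤ B) (fb : ∃ B : ℝ, ∀ x, |f x| ≤ B) (gb : ∃ B : ℝ, ∀ x, |g x| ≤ B)
    (h0 : ∀ x, 0 ≤ h x)
    (hd : ∀ a b b' b₁ b₂, h (M (a, b, b')) = h (M (a, b₁, b₂)))
    (fd : ∀ a b b' b₂, f (M (a, b, b')) = f (M (a, b, b₂)))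
    (gd : ∀ a b b' b₂, g (M (a, b, b')) = g (M (a, b, b₂))) :
    (∫ x, h x * (f x * g (τ x)) ∂P) ^ 2 ≤
      (∫ x, h x * (f x * f (τ x)) ∂P) * ∫ x, h x * (g x * g (τ x)) ∂P := by
  obtain ⟨b₀⟩ := ‹Nonempty β›
  -- Pulling back along `M` gives the bilinear form above; the arbitrary point `b₀` fills the
  -- coordinates that the functions ignore.
  have tr : ∀ {f g : Ω → ℝ}, Measurable f → Measurable g →
      (∀ a b b' b₂, f (M (a, b, b')) = f (M (a, b, b₂))) →
      (∀ a b b' b₂, g (M (a, b, b')) = g (M (a, b, b₂))) →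
      ∫ x, h x * (f x * g (τ x)) ∂P = ∫ p : α × (β × β), h (M (p.1, b₀, b₀)) *
        (f (M (p.1, p.2.1, b₀)) * g (M (p.1, p.2.2, b₀))) ∂(μ.prod (ν.prod ν)) := by
    intro f g fm gm fd gd
    rw [← hM.map_eq, integral_map hM.measurable.aemeasurable
      (Measurable.aestronglyMeasurable (by fun_prop))]
    refine integral_congr_ae (Filter.Eventually.of_forall fun p => ?_)
    obtain ⟨a, b, b'⟩ := p
    simp only [hMτ]
    rw [hd a b b' b₀ b₀, fd a b b' b₀, gd a b' b b₀]
  rw [tr fm gm fd gd, tr fm fm fd fd, tr gm gm gd gd]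
  have := hM.measurable
  exact integral_mul_mul_sq_le (h := fun a => h (M (a, b₀, b₀)))
    (f := fun q : α × β => f (M (q.1, q.2, b₀))) (g := fun q : α × β => g (M (q.1, q.2, b₀)))
    (by fun_prop) (by fun_prop) (by fun_prop) (hb.imp fun _ h _ => h _) (fb.imp fun _ h _ => h _)
    (gb.imp fun _ h _ => h _) (fun _ => h0 _)

end ReflectionPositivity

/-! ### Gluing product measures along an involution -/

section Glue

/-- Two points `b`, `b'` of `X^V` glued over a point `a` along an involution `σ` of `V`: `b` is used
on `P`, a reflected copy of `b'` on `σ(P)`, and `a` elsewhere. -/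
noncomputable def glue {V X : Type*} (σ : Equiv.Perm V) (P : V → Prop)
    (q : (V → X) × ((V → X) × (V → X))) : V → X := by
  classical
  exact fun v => if P v then q.2.1 v else if P (σ v) then q.2.2 (σ v) else q.1 v

variable {V X : Type*} {σ : Equiv.Perm V} {P : V → Prop}

lemma glue_of_pos {v : V} (h : P v) (q : (V → X) × ((V → X) × (V → X))) :
    glue σ P q v = q.2.1 v := by simp [glue, h]

lemma glue_of_neg (hP : ∀ v, P v → ¬ P (σ v)) {v : V} (h : P (σ v))
    (q : (V → X) × ((V → X) × (V → X))) : glue σ P q v = q.2.2 (σ v) := by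
  have h' : ¬ P v := fun h' => hP v h' h
  simp [glue, h, h']

lemma glue_of_zero {v : V} (h : ¬ P v) (h' : ¬ P (σ v)) (q : (V → X) × ((V → X) × (V → X))) :
    glue σ P q v = q.1 v := by simp [glue, h, h']

/-- The involution exchanges the two glued halves. -/
lemma glue_reflect (hσ : ∀ v, σ (σ v) = v) (hP : ∀ v, P v → ¬ P (σ v))
    (h0 : ∀ v, ¬ P v → ¬ P (σ v) → σ v = v) (a b b' : V → X) :
    (fun v => glue σ P (a, b, b') (σ v)) = glue σ P (a, b', b) := by
  funext v
  by_cases h : P v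
  · rw [glue_of_pos h, glue_of_neg hP (by rwa [hσ]), hσ]
  by_cases h' : P (σ v)
  · rw [glue_of_pos h', glue_of_neg hP h']
  · rw [h0 v h h', glue_of_zero h h', glue_of_zero h h']

/-- Gluing preserves product measures. -/
lemma measurePreserving_glue [Fintype V] [MeasurableSpace X] (μ : Measure X)
    [IsProbabilityMeasure μ] (hσ : ∀ v, σ (σ v) = v) (hP : ∀ v, P v → ¬ P (σ v)) :
    MeasurePreserving (glue σ P)
      ((Measure.pi fun _ : V => μ).prod
        ((Measure.pi fun _ : V => μ).prod (Measure.pi fun _ : V => μ)))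
      (Measure.pi fun _ : V => μ) := by
  classical
  have meas : Measurable (glue σ P : _ → V → X) := by
    refine measurable_pi_lambda _ fun v => ?_
    by_cases h : P v
    · simp only [glue_of_pos h]; fun_prop
    by_cases h' : P (σ v)
    · simp only [glue_of_neg hP h']; fun_prop
    · simp only [glue_of_zero h h']; fun_prop
  refine ⟨meas, (Measure.pi_eq fun s hs => ?_).symm⟩
  rw [Measure.map_apply meas (.univ_pi hs)]
  have pre : glue σ P ⁻¹' Set.univ.pi s =
      (Set.univ.pi fun v => if ¬ P v ∧ ¬ P (σ v) then s v else Set.univ) ×ˢ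
      ((Set.univ.pi fun v => if P v then s v else Set.univ) ×ˢ
        (Set.univ.pi fun v => if P v then s (σ v) else Set.univ)) := by
    ext ⟨a, b, b'⟩
    simp only [Set.mem_preimage, Set.mem_pi, Set.mem_univ, forall_const, Set.mem_prod]
    constructor
    · intro h
      refine ⟨fun v => ?_, fun v => ?_, fun v => ?_⟩
      · split_ifs with hv
        · simpa [glue_of_zero hv.1 hv.2] using h v
        · trivial
      · split_ifs with hv
        · simpa [glue_of_pos hv] using h v
        · trivial
      · split_ifs with hv
        · have := h (σ v)
          rwa [glue_of_neg hP (by rwa [hσ]), hσ] at this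
        · trivial
    · rintro ⟨h₀, h₁, h₂⟩ v
      by_cases h : P v
      · simpa [glue_of_pos h, h] using h₁ v
      by_cases h' : P (σ v)
      · simpa [glue_of_neg hP h', h', hσ] using h₂ (σ v)
      · simpa [glue_of_zero h h', h, h'] using h₀ v
  -- Reindexing the third product by `σ` makes exactly one of the three factors at each `v` equal to
  -- `μ (s v)`, and the other two equal to 1.
  rw [pre, Measure.prod_prod, Measure.prod_prod, Measure.pi_pi, Measure.pi_pi, Measure.pi_pi,
    ← Equiv.prod_comp σ (fun v => μ (if P v then s (σ v) else Set.univ)),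
    ← Finset.prod_mul_distrib, ← Finset.prod_mul_distrib]
  refine Finset.prod_congr rfl fun v _ => ?_
  by_cases h : P v
  · simp [h, hP v h]
  by_cases h' : P (σ v)
  · simp [h, h', hσ]
  · simp [h, h']

/-- The canonical rearrangement of a product of two products. -/
lemma measurePreserving_prodProdProdComm {A B C D : Type*} [MeasurableSpace A] [MeasurableSpace B]
    [MeasurableSpace C] [MeasurableSpace D] (a : Measure A) (b : Measure B) (c : Measure C)
    (d : Measure D) [SFinite a] [SFinite b] [SFinite c] [SFinite d] :
    MeasurePreserving (Equiv.prodProdProdComm A B C D) ((a.prod b).prod (c.prod d))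
      ((a.prod c).prod (b.prod d)) := by
  have h₁ := measurePreserving_prodAssoc a b (c.prod d)
  have h₂ := (MeasurePreserving.id a).prod ((measurePreserving_prodAssoc b c d).symm)
  have h₃ := (MeasurePreserving.id a).prod
    ((Measure.measurePreserving_swap (μ := b) (ν := c)).prod (MeasurePreserving.id d))
  have h₄ := (MeasurePreserving.id a).prod (measurePreserving_prodAssoc c b d)
  have h₅ := (measurePreserving_prodAssoc a c (b.prod d)).symm
  exact h₅.comp (h₄.comp (h₃.comp (h₂.comp h₁)))

end Glue

/-! ### Folding a colored bigraph along an involutive automorphism -/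

namespace Bigraph

variable {V₁ V₂ C C' : Type*}

/-- An involutive automorphism `(σ₁, σ₂)` of the colored bigraph `(G, c)` that folds it: the
vertices that it moves are divided into a positive side `P₁`, `P₂` and its mirror image, and no edge
joins the two sides. -/
structure IsFold (G : Bigraph V₁ V₂) (c : G.Coloring C) (σ₁ : Equiv.Perm V₁) (σ₂ : Equiv.Perm V₂)
    (P₁ : V₁ → Prop) (P₂ : V₂ → Prop) : Prop where
  aut : G.IsColorAut c σ₁ σ₂
  invol₁ : ∀ v, σ₁ (σ₁ v) = v
  invol₂ : ∀ w, σ₂ (σ₂ w) = w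
  asymm₁ : ∀ v, P₁ v → ¬ P₁ (σ₁ v)
  asymm₂ : ∀ w, P₂ w → ¬ P₂ (σ₂ w)
  fix₁ : ∀ v, ¬ P₁ v → ¬ P₁ (σ₁ v) → σ₁ v = v
  fix₂ : ∀ w, ¬ P₂ w → ¬ P₂ (σ₂ w) → σ₂ w = w
  sep : ∀ v w, (v, w) ∈ G.edges → P₁ v → ¬ P₂ (σ₂ w)

open Classical in
/-- The map folding the mirror image of the side `P` onto `P`. -/
noncomputable def foldOnto {V : Type*} (σ : Equiv.Perm V) (P : V → Prop) (v : V) : V :=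
  if P (σ v) then σ v else v

open Classical in
/-- The map folding the side `P` onto its mirror image. -/
noncomputable def foldAway {V : Type*} (σ : Equiv.Perm V) (P : V → Prop) (v : V) : V :=
  if P v then σ v else v

namespace IsFold

variable {G : Bigraph V₁ V₂} {c : G.Coloring C'} {σ₁ : Equiv.Perm V₁} {σ₂ : Equiv.Perm V₂}
  {P₁ : V₁ → Prop} {P₂ : V₂ → Prop}

lemma sep' (hF : G.IsFold c σ₁ σ₂ P₁ P₂) {v : V₁} {w : V₂} (h : (v, w) ∈ G.edges)
    (hv : P₁ (σ₁ v)) : ¬ P₂ w := by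
  have := hF.sep _ _ ((hF.aut.1 v w).1 h) hv
  rwa [hF.invol₂] at this

/-- The permutation of the edges induced by a fold. -/
def edgePerm (hF : G.IsFold c σ₁ σ₂ P₁ P₂) : Equiv.Perm {e : V₁ × V₂ // e ∈ G.edges} where
  toFun e := ⟨(σ₁ e.1.1, σ₂ e.1.2), (hF.aut.1 _ _).1 e.2⟩
  invFun e := ⟨(σ₁ e.1.1, σ₂ e.1.2), (hF.aut.1 _ _).1 e.2⟩
  left_inv e := by simp [hF.invol₁, hF.invol₂]
  right_inv e := by simp [hF.invol₁, hF.invol₂]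

lemma edgePerm_edgePerm (hF : G.IsFold c σ₁ σ₂ P₁ P₂) (e : {e : V₁ × V₂ // e ∈ G.edges}) :
    hF.edgePerm (hF.edgePerm e) = e := hF.edgePerm.left_inv e

lemma color_edgePerm (hF : G.IsFold c σ₁ σ₂ P₁ P₂) (e : {e : V₁ × V₂ // e ∈ G.edges}) :
    c (hF.edgePerm e) = c e := (hF.aut.2 _ _ e.2 (hF.edgePerm e).2).symm

end IsFold

/-- An edge is positive if one of its ends is. -/
def PosEdge {G : Bigraph V₁ V₂} (P₁ : V₁ → Prop) (P₂ : V₂ → Prop)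
    (e : {e : V₁ × V₂ // e ∈ G.edges}) : Prop := P₁ e.1.1 ∨ P₂ e.1.2

/-- This is where separation enters: the ends of a positive edge are positive or fixed, so the
positive edges are disjoint from their mirror images. -/
lemma IsFold.not_posEdge_edgePerm {G : Bigraph V₁ V₂} {c : G.Coloring C'} {σ₁ : Equiv.Perm V₁}
    {σ₂ : Equiv.Perm V₂} {P₁ : V₁ → Prop} {P₂ : V₂ → Prop} (hF : G.IsFold c σ₁ σ₂ P₁ P₂)
    {e : {e : V₁ × V₂ // e ∈ G.edges}} (he : PosEdge P₁ P₂ e) :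
    ¬ P₁ (σ₁ e.1.1) ∧ ¬ P₂ (σ₂ e.1.2) := by
  rcases he with h | h
  · exact ⟨hF.asymm₁ _ h, hF.sep _ _ e.2 h⟩
  · exact ⟨fun h' => hF.sep' e.2 h' h, hF.asymm₂ _ h⟩

/-! ### Cauchy–Schwarz for densities along a fold -/

section Density

variable {X Y : Type*}

open Classical in
/-- The factor of the density integrand that comes from the edges satisfying `Q`. -/
noncomputable def partialWeight (G : Bigraph V₁ V₂) (c : G.Coloring C') (W : C × C' → X × Y → ℝ)
    (Q : {e : V₁ × V₂ // e ∈ G.edges} → Prop) (l : V₁ → C) (p : (V₁ → X) × (V₂ → Y)) : ℝ :=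
  ∏ e : {e : V₁ × V₂ // e ∈ G.edges}, if Q e then W (l e.1.1, c e) (p.1 e.1.1, p.2 e.1.2) else 1

variable {G : Bigraph V₁ V₂} {c : G.Coloring C'} {W : C × C' → X × Y → ℝ}
  {Q : {e : V₁ × V₂ // e ∈ G.edges} → Prop}

lemma partialWeight_congr {l l' : V₁ → C} {p p' : (V₁ → X) × (V₂ → Y)}
    (h : ∀ e : {e : V₁ × V₂ // e ∈ G.edges}, Q e →
      l e.1.1 = l' e.1.1 ∧ p.1 e.1.1 = p'.1 e.1.1 ∧ p.2 e.1.2 = p'.2 e.1.2) :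
    G.partialWeight c W Q l p = G.partialWeight c W Q l' p' := by
  refine Finset.prod_congr rfl fun e _ => ?_
  split_ifs with hQ
  · obtain ⟨h₁, h₂, h₃⟩ := h e hQ
    rw [h₁, h₂, h₃]
  · rfl

variable {σ₁ : Equiv.Perm V₁} {σ₂ : Equiv.Perm V₂} {P₁ : V₁ → Prop} {P₂ : V₂ → Prop}

/-- The density integrand splits along a fold into the factor of the edges on the mirror, the
factor of the positive edges, and a reflected factor of positive edges. -/
lemma IsFold.prod_eq (hF : G.IsFold c σ₁ σ₂ P₁ P₂) (l : V₁ → C) (p : (V₁ → X) × (V₂ → Y)) :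
    ∏ e : {e : V₁ × V₂ // e ∈ G.edges}, W (G.leftTensor l c e) (p.1 e.1.1, p.2 e.1.2) =
      G.partialWeight c W
        (fun e => ¬ PosEdge P₁ P₂ e ∧ ¬ PosEdge P₁ P₂ (hF.edgePerm e)) l p *
      (G.partialWeight c W (PosEdge P₁ P₂) l p *
        G.partialWeight c W (PosEdge P₁ P₂) (fun v => l (σ₁ v))
          (fun v => p.1 (σ₁ v), fun w => p.2 (σ₂ w))) := by
  classical
  -- Reindexing by the edge involution turns the reflected factor into a product over the edges
  -- whose mirror image is positive.
  have h : G.partialWeight c W (PosEdge P₁ P₂) (fun v => l (σ₁ v))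
      (fun v => p.1 (σ₁ v), fun w => p.2 (σ₂ w)) =
      ∏ e : {e : V₁ × V₂ // e ∈ G.edges}, if PosEdge P₁ P₂ (hF.edgePerm e) then
        W (l e.1.1, c e) (p.1 e.1.1, p.2 e.1.2) else 1 := by
    rw [← Equiv.prod_comp hF.edgePerm]
    refine Finset.prod_congr rfl fun e _ => ?_
    rw [hF.edgePerm_edgePerm, hF.color_edgePerm]
    rfl
  rw [h, partialWeight, partialWeight, ← Finset.prod_mul_distrib, ← Finset.prod_mul_distrib]
  refine Finset.prod_congr rfl fun e _ => ?_
  by_cases h₁ : PosEdge P₁ P₂ e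
  · have h₂ : ¬ PosEdge P₁ P₂ (hF.edgePerm e) := not_or.2 (hF.not_posEdge_edgePerm h₁)
    simp [h₁, h₂, leftTensor]
  · by_cases h₂ : PosEdge P₁ P₂ (hF.edgePerm e) <;> simp [h₁, h₂, leftTensor]

variable [MeasurableSpace X] [MeasurableSpace Y]

lemma partialWeight_nonneg (hW : ∀ i, IsBigraphon (W i)) (l : V₁ → C)
    (p : (V₁ → X) × (V₂ → Y)) : 0 ≤ G.partialWeight c W Q l p := by
  refine Finset.prod_nonneg fun e _ => ?_
  split_ifs
  exacts [(hW _).nonneg _, zero_le_one]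

lemma measurable_partialWeight (hW : ∀ i, IsBigraphon (W i)) (l : V₁ → C) :
    Measurable (G.partialWeight c W Q l) := by
  refine Finset.measurable_prod _ fun e _ => ?_
  split_ifs
  · have := (hW (l e.1.1, c e)).measurable
    fun_prop
  · exact measurable_const

lemma abs_partialWeight_le (hW : ∀ i, IsBigraphon (W i)) (l : V₁ → C) :
    ∃ B : ℝ, ∀ p, |G.partialWeight c W Q l p| ≤ B := by
  classical
  choose B hB using fun i => (hW i).bounded
  refine ⟨∏ e : {e : V₁ × V₂ // e ∈ G.edges}, if Q e then B (l e.1.1, c e) else 1, fun p => ?_⟩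
  rw [abs_of_nonneg (partialWeight_nonneg hW l p)]
  refine Finset.prod_le_prod (fun e _ => ?_) fun e _ => ?_
  · split_ifs
    exacts [(hW _).nonneg _, zero_le_one]
  · split_ifs
    exacts [hB _ _, le_rfl]

lemma density_nonneg [Fintype V₁] [Fintype V₂] (hW : ∀ i, IsBigraphon (W i)) (μ : Measure X)
    (ν : Measure Y) (l : V₁ → C) : 0 ≤ G.density (G.leftTensor l c) μ ν W :=
  integral_nonneg fun _ => Finset.prod_nonneg fun _ _ => (hW _).nonneg _

/-- The Cauchy–Schwarz inequality for a fold. -/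
theorem IsFold.sq_density_le [Fintype V₁] [Fintype V₂] (hF : G.IsFold c σ₁ σ₂ P₁ P₂)
    (hW : ∀ i, IsBigraphon (W i)) (μ : Measure X) (ν : Measure Y) [IsProbabilityMeasure μ]
    [IsProbabilityMeasure ν] (l : V₁ → C) :
    G.density (G.leftTensor l c) μ ν W ^ 2 ≤
      G.density (G.leftTensor (fun v => l (foldOnto σ₁ P₁ v)) c) μ ν W *
      G.density (G.leftTensor (fun v => l (foldAway σ₁ P₁ v)) c) μ ν W := by
  have hX := nonempty_of_isProbabilityMeasure μ
  have hY := nonempty_of_isProbabilityMeasure ν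
  let τ : (V₁ → X) × (V₂ → Y) → (V₁ → X) × (V₂ → Y) :=
    fun p => (fun v => p.1 (σ₁ v), fun w => p.2 (σ₂ w))
  let Q : {e : V₁ × V₂ // e ∈ G.edges} → Prop :=
    fun e => ¬ PosEdge P₁ P₂ e ∧ ¬ PosEdge P₁ P₂ (hF.edgePerm e)
  let l' : V₁ → C := fun v => l (σ₁ v)
  -- the measure-preserving gluing map
  let μ' := Measure.pi fun _ : V₁ => μ
  let ν' := Measure.pi fun _ : V₂ => ν
  let M : ((V₁ → X) × (V₂ → Y)) × (((V₁ → X) × (V₂ → Y)) × ((V₁ → X) × (V₂ → Y))) →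
      (V₁ → X) × (V₂ → Y) := fun q =>
    (glue σ₁ P₁ (q.1.1, q.2.1.1, q.2.2.1), glue σ₂ P₂ (q.1.2, q.2.1.2, q.2.2.2))
  have hM : MeasurePreserving M ((μ'.prod ν').prod ((μ'.prod ν').prod (μ'.prod ν')))
      (μ'.prod ν') :=
    ((measurePreserving_glue μ hF.invol₁ hF.asymm₁).prod
      (measurePreserving_glue ν hF.invol₂ hF.asymm₂)).comp
      ((measurePreserving_prodProdProdComm μ' ν' (μ'.prod μ') (ν'.prod ν')).comp
        ((MeasurePreserving.id (μ'.prod ν')).prod (measurePreserving_prodProdProdComm μ' ν' μ' ν')))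
  have hτ : Measurable τ := by fun_prop
  have hMτ : ∀ a b b', τ (M (a, b, b')) = M (a, b', b) := fun a b b' =>
    Prod.ext (glue_reflect hF.invol₁ hF.asymm₁ hF.fix₁ _ _ _)
      (glue_reflect hF.invol₂ hF.asymm₂ hF.fix₂ _ _ _)
  -- Edges in `Q` have only fixed ends, where the glued point is read from `a`.
  have depQ : ∀ a b b' b₁ b₂, G.partialWeight c W Q l (M (a, b, b')) =
      G.partialWeight c W Q l (M (a, b₁, b₂)) := fun a b b' b₁ b₂ =>
    partialWeight_congr fun e ⟨h, h'⟩ => by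
      have ⟨n₁, n₂⟩ := not_or.1 h
      have ⟨m₁, m₂⟩ := not_or.1 h'
      exact ⟨rfl, by simp only [M]; rw [glue_of_zero n₁ m₁, glue_of_zero n₁ m₁],
        by simp only [M]; rw [glue_of_zero n₂ m₂, glue_of_zero n₂ m₂]⟩
  -- A positive edge has no end on the mirror side, so it never sees `b'`.
  have dep : ∀ (m : V₁ → C) a b b' b₂, G.partialWeight c W (PosEdge P₁ P₂) m (M (a, b, b')) =
      G.partialWeight c W (PosEdge P₁ P₂) m (M (a, b, b₂)) := fun m a b b' b₂ =>
    partialWeight_congr fun e h => by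
      obtain ⟨m₁, m₂⟩ := hF.not_posEdge_edgePerm h
      refine ⟨rfl, ?_, ?_⟩
      · by_cases n : P₁ e.1.1
        · simp only [M]; rw [glue_of_pos n, glue_of_pos n]
        · simp only [M]; rw [glue_of_zero n m₁, glue_of_zero n m₁]
      · by_cases n : P₂ e.1.2
        · simp only [M]; rw [glue_of_pos n, glue_of_pos n]
        · simp only [M]; rw [glue_of_zero n m₂, glue_of_zero n m₂]
  have key := sq_integral_mul_comp_le hM hτ hMτ (measurable_partialWeight (c := c) (Q := Q) hW l)
    (measurable_partialWeight (c := c) (Q := PosEdge P₁ P₂) hW l)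
    (measurable_partialWeight (c := c) (Q := PosEdge P₁ P₂) hW l')
    (abs_partialWeight_le hW l) (abs_partialWeight_le hW l) (abs_partialWeight_le hW l')
    (partialWeight_nonneg hW l) depQ (dep l) (dep l')
  have zero : ∀ e : {e : V₁ × V₂ // e ∈ G.edges}, Q e → ¬ P₁ e.1.1 ∧ ¬ P₁ (σ₁ e.1.1) :=
    fun e ⟨h, h'⟩ => ⟨(not_or.1 h).1, (not_or.1 h').1⟩
  have d₀ : G.density (G.leftTensor l c) μ ν W = ∫ p, G.partialWeight c W Q l p *
      (G.partialWeight c W (PosEdge P₁ P₂) l p *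
        G.partialWeight c W (PosEdge P₁ P₂) l' (τ p)) ∂(μ'.prod ν') :=
    integral_congr_ae (Filter.Eventually.of_forall fun p => hF.prod_eq l p)
  -- The folded labeling is mirror symmetric and agrees with `l` at left ends of positive edges. For
  -- `foldAway` below, `l'` takes this role.
  have d₁ : G.density (G.leftTensor (fun v => l (foldOnto σ₁ P₁ v)) c) μ ν W =
      ∫ p, G.partialWeight c W Q l p * (G.partialWeight c W (PosEdge P₁ P₂) l p *
        G.partialWeight c W (PosEdge P₁ P₂) l (τ p)) ∂(μ'.prod ν') := by
    refine integral_congr_ae (Filter.Eventually.of_forall fun p => (hF.prod_eq _ p).trans ?_)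
    congr 1
    · refine partialWeight_congr fun e h => ⟨?_, rfl, rfl⟩
      simp [foldOnto, zero e h]
    congr 1
    · refine partialWeight_congr fun e h => ⟨?_, rfl, rfl⟩
      simp [foldOnto, hF.not_posEdge_edgePerm h]
    · refine partialWeight_congr fun e h => ⟨?_, rfl, rfl⟩
      by_cases n : P₁ e.1.1
      · simp [foldOnto, hF.invol₁, n]
      · simp [foldOnto, n, hF.fix₁ _ n (hF.not_posEdge_edgePerm h).1]
  have d₂ : G.density (G.leftTensor (fun v => l (foldAway σ₁ P₁ v)) c) μ ν W =
      ∫ p, G.partialWeight c W Q l p * (G.partialWeight c W (PosEdge P₁ P₂) l' p *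
        G.partialWeight c W (PosEdge P₁ P₂) l' (τ p)) ∂(μ'.prod ν') := by
    refine integral_congr_ae (Filter.Eventually.of_forall fun p => (hF.prod_eq _ p).trans ?_)
    congr 1
    · refine partialWeight_congr fun e h => ⟨?_, rfl, rfl⟩
      simp [foldAway, zero e h]
    congr 1
    · refine partialWeight_congr fun e h => ⟨?_, rfl, rfl⟩
      by_cases n : P₁ e.1.1
      · simp [foldAway, l', n]
      · simp [foldAway, l', n, hF.fix₁ _ n (hF.not_posEdge_edgePerm h).1]
    · refine partialWeight_congr fun e h => ⟨?_, rfl, rfl⟩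
      simp [foldAway, l', hF.not_posEdge_edgePerm h]
  rw [d₀, d₁, d₂]
  exact key

end Density

end Bigraph

/-! ### From folds to a Hölder inequality -/

/-- Termwise, the images of `v` under the two foldings are `v` and `σ v` in some order. -/
lemma Bigraph.prod_foldOnto_mul_prod_foldAway {V : Type*} [Fintype V] {σ : Equiv.Perm V}
    {P : V → Prop} (hP : ∀ v, P v → ¬ P (σ v)) (h0 : ∀ v, ¬ P v → ¬ P (σ v) → σ v = v)
    (g : V → ℝ) :
    (∏ v, g (foldOnto σ P v)) * ∏ v, g (foldAway σ P v) = (∏ v, g v) ^ 2 := by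
  rw [sq]
  nth_rewrite 4 [← Equiv.prod_comp σ]
  rw [← Finset.prod_mul_distrib, ← Finset.prod_mul_distrib]
  refine Finset.prod_congr rfl fun v _ => ?_
  by_cases h : P v
  · simp [foldOnto, foldAway, h, hP v h]
  · by_cases h' : P (σ v)
    · simp [foldOnto, foldAway, h, h', mul_comm]
    · simp [foldOnto, foldAway, h, h0 v h h']

/-- A nonnegative functional `T` of self-maps of `V` that satisfies a Cauchy–Schwarz inequality for
a family of pairs of folding maps satisfies a Hölder inequality, provided that some sequence of
foldings contracts `V` to a point from which every other point can be reached. -/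
theorem le_prod_rpow_of_folds {V ι : Type*} [Fintype V] (T : (V → V) → ℝ)
    (hT : ∀ f, 0 ≤ T f) (φ ψ : ι → V → V)
    (hCS : ∀ f i, T f ^ 2 ≤ T (fun v => f (φ i v)) * T (fun v => f (ψ i v)))
    (hcount : ∀ (g : V → ℝ) i, (∏ v, g (φ i v)) * ∏ v, g (ψ i v) = (∏ v, g v) ^ 2)
    (p : V) (L : List ι) (hL : ∀ v, L.foldr φ v = p)
    (hreach : ∀ v, Relation.ReflTransGen (fun u u' => ∃ i, u' = φ i u ∨ u' = ψ i u) p v) :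
    T id ≤ ∏ v, T (fun _ => v) ^ (1 / (Fintype.card V : ℝ)) := by
  classical
  rcases (hT id).eq_or_lt with h0 | hpos
  · rw [← h0]
    exact Finset.prod_nonneg fun v _ => Real.rpow_nonneg (hT _) _
  have step : ∀ f i, 0 < T f → 0 < T (fun v => f (φ i v)) ∧ 0 < T (fun v => f (ψ i v)) := by
    intro f i hf
    have := (pow_pos hf 2).trans_le (hCS f i)
    constructor
    · exact pos_of_mul_pos_left this (hT _)
    · exact pos_of_mul_pos_right this (hT _)
  -- A property stable under precomposition with every `φ i` passes from `f` to the constant map `f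
  -- p`, by running through `L`.
  have contract : ∀ Q : (V → V) → Prop, (∀ f i, Q f → Q (fun v => f (φ i v))) →
      ∀ f, Q f → Q (fun _ => f p) := by
    intro Q hQ f hf
    have : ∀ (L : List ι) f, Q f → Q (fun v => f (L.foldr φ v)) := by
      intro L
      induction L with
      | nil => exact fun f hf => hf
      | cons i L ih => exact fun f hf => ih (fun v => f (φ i v)) (hQ f i hf)
    simpa only [hL] using this L f hf
  have qpos : ∀ v, 0 < T (fun _ => v) := by
    intro v
    -- Quantifying over `f` lets the induction precompose with the last fold of the path from `p` to
    -- `v`.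
    suffices h : ∀ f, 0 < T f → 0 < T (fun _ => f v) from h id hpos
    induction hreach v with
    | refl => exact contract (fun f => 0 < T f) fun f i h => (step f i h).1
    | tail _ h ih =>
      obtain ⟨i, rfl | rfl⟩ := h
      · exact fun f hf => ih _ (step f i hf).1
      · exact fun f hf => ih _ (step f i hf).2
  let D : (V → V) → ℝ := fun f => ∏ v, T (fun _ => f v) ^ (1 / (Fintype.card V : ℝ))
  have Dpos : ∀ f, 0 < D f := fun f => Finset.prod_pos fun v _ => Real.rpow_pos_of_pos (qpos _) _
  have Dmul : ∀ f i, D (fun v => f (φ i v)) * D (fun v => f (ψ i v)) = D f ^ 2 := fun f i =>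
    hcount (fun v => T (fun _ => f v) ^ (1 / (Fintype.card V : ℝ))) i
  have Dconst : ∀ v, D (fun _ => v) = T (fun _ => v) := by
    intro v
    have : (Fintype.card V : ℝ) ≠ 0 := by
      have : Nonempty V := ⟨p⟩
      exact_mod_cast Fintype.card_ne_zero
    simp only [D, Finset.prod_const, Finset.card_univ]
    rw [← Real.rpow_natCast, ← Real.rpow_mul (hT _), one_div, inv_mul_cancel₀ this, Real.rpow_one]
  have : Nonempty (V → V) := ⟨id⟩
  obtain ⟨f₀, hf₀⟩ := Finite.exists_max fun f => T f / D f
  have max₀ : ∀ f, T f / D f ≤ T f₀ / D f₀ := hf₀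
  have mpos : 0 < T f₀ / D f₀ := (div_pos hpos (Dpos id)).trans_le (max₀ id)
  -- With `m` the maximal ratio, Cauchy–Schwarz bounds `m²` by the product of the ratios at the two
  -- folded maps. The `ψ` ratio is at most `m`, so the `φ` ratio is at least `m`.
  have const := contract (fun f => T f / D f = T f₀ / D f₀) (by
    intro f i hf
    refine le_antisymm (max₀ _) ?_
    have h₁ : (T f / D f) ^ 2 ≤ (T (fun v => f (φ i v)) / D (fun v => f (φ i v))) *
        (T (fun v => f (ψ i v)) / D (fun v => f (ψ i v))) := by
      rw [div_pow, div_mul_div_comm, Dmul]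
      exact div_le_div_of_nonneg_right (hCS f i) (by positivity)
    rw [hf] at h₁
    have h₂ : (T (fun v => f (φ i v)) / D (fun v => f (φ i v))) *
        (T (fun v => f (ψ i v)) / D (fun v => f (ψ i v))) ≤
        (T (fun v => f (φ i v)) / D (fun v => f (φ i v))) * (T f₀ / D f₀) :=
      mul_le_mul_of_nonneg_left (max₀ _) (div_nonneg (hT _) (Dpos _).le)
    have h₃ := h₁.trans h₂
    rw [sq] at h₃
    exact le_of_mul_le_mul_right h₃ mpos) f₀ rfl
  rw [Dconst, div_self (qpos _).ne'] at const
  have := max₀ id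
  rwa [← const, div_le_one (Dpos id)] at this

/-- A colored bigraph whose left side is contracted to a point by some sequence of folds is
left-weakly Hölder, provided that all left vertices can be reached from that point. -/
theorem Bigraph.leftWeaklyHolder_of_folds {V₁ : Type v₁} {V₂ : Type v₂} {C' : Type c'}
    [Fintype V₁] [Fintype V₂] {G : Bigraph V₁ V₂} {c : G.Coloring C'} {ι : Type*}
    (σ₁ : ι → Equiv.Perm V₁) (σ₂ : ι → Equiv.Perm V₂) (P₁ : ι → V₁ → Prop) (P₂ : ι → V₂ → Prop)
    (hF : ∀ i, G.IsFold c (σ₁ i) (σ₂ i) (P₁ i) (P₂ i)) (p : V₁) (L : List ι)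
    (hL : ∀ v, L.foldr (fun i => foldOnto (σ₁ i) (P₁ i)) v = p)
    (hreach : ∀ v, Relation.ReflTransGen (fun u u' => ∃ i,
      u' = foldOnto (σ₁ i) (P₁ i) u ∨ u' = foldAway (σ₁ i) (P₁ i) u) p v) :
    LeftWeaklyHolder.{v₁, v₂, c', u, x, y} G c := by
  intro C l X Y _ _ μ ν _ _ W hW
  exact le_prod_rpow_of_folds
    (fun f => G.density (G.leftTensor (fun v => l (f v)) c) μ ν W)
    (fun f => density_nonneg hW μ ν _) (fun i => foldOnto (σ₁ i) (P₁ i))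
    (fun i => foldAway (σ₁ i) (P₁ i)) (fun f i => (hF i).sq_density_le hW μ ν fun v => l (f v))
    (fun g i => prod_foldOnto_mul_prod_foldAway (hF i).asymm₁ (hF i).fix₁ g) p L hL hreach

/-! ### Words in the simple reflections -/

namespace ReflectionGroup

/-- `IsWord S k r` means that `r` is a product of `k` elements of `S`. -/
inductive IsWord {R : Type*} [Group R] (S : Set R) : ℕ → R → Prop
  | one : IsWord S 0 1
  | cons {k : ℕ} {s r : R} : s ∈ S → IsWord S k r → IsWord S (k + 1) (s * r)

variable {n : ℕ} {R : Subgroup (GLn n)} {b : Module.Basis (Fin n) ℝ (Euc n)} {Δ : Set (Euc n)}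

section

variable {α : Euc n} {s : R}

lemma mul_self_of_eq (hs : (s : GLn n) = hyperplaneReflection α) : s * s = 1 :=
  Subtype.ext (by simp [hs, hyperplaneReflection_mul_self])

lemma inv_eq_of_eq (hs : (s : GLn n) = hyperplaneReflection α) : s⁻¹ = s :=
  inv_eq_of_mul_eq_one_left (mul_self_of_eq hs)

lemma inv_mul_apply_root (hs : (s : GLn n) = hyperplaneReflection α) (r : R) :
    ((s * r)⁻¹ : R).1 α = -((r⁻¹ : R).1 α) := by
  rw [mul_inv_rev, inv_eq_of_eq hs, Subgroup.coe_mul, LinearEquiv.mul_apply, hs,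
    hyperplaneReflection_self, map_neg]

end

lemma exists_isWord [Finite R] (hR : IsReflectionGroup R) (hΔ : IsSimpleSystem R b Δ) (r : R) :
    ∃ k, IsWord (simpleReflections R Δ) k r := by
  have hr : r ∈ Subgroup.closure (simpleReflections R Δ) := by
    rw [closure_simpleReflections hR hΔ]; trivial
  induction hr using Subgroup.closure_induction_left with
  | one => exact ⟨0, .one⟩
  | mul_left x hx y _ ih =>
    obtain ⟨k, hk⟩ := ih
    exact ⟨_, .cons hx hk⟩
  | inv_mul_cancel x hx y _ ih =>
    obtain ⟨k, hk⟩ := ih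
    obtain ⟨α, -, hs⟩ := id hx
    refine ⟨k + 1, ?_⟩
    rw [inv_eq_of_eq hs]
    exact .cons hx hk

/-- The strong exchange property. -/
lemma IsWord.exchange (hR : IsReflectionGroup R) (hΔ : IsSimpleSystem R b Δ) {k : ℕ} {w : R}
    (hw : IsWord (simpleReflections R Δ) k w) {β : Euc n} (hβ : β ∈ positiveRoots R b) {t : R}
    (ht : (t : GLn n) = hyperplaneReflection β) (hneg : (w⁻¹ : R).1 β ∉ positiveRoots R b) :
    ∃ k', k = k' + 1 ∧ IsWord (simpleReflections R Δ) k' (t * w) := by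
  induction hw generalizing β t with
  | one => exact absurd (by simpa using hβ) hneg
  | @cons k s w hs hw ih =>
    obtain ⟨α, hα, hsα⟩ := id hs
    by_cases h : β = α
    -- Here `t` is the first letter of the word, and cancels it.
    · subst h
      have : t = s := Subtype.ext (ht.trans hsα.symm)
      refine ⟨k, rfl, ?_⟩
      rwa [this, ← mul_assoc, mul_self_of_eq hsα, one_mul]
    -- Otherwise `s_α β` is still positive, and the deletion takes place in the tail, with `t`
    -- conjugated by `s`.
    · have hβ' := simple_map_mem_positiveRoots hR hΔ hα hβ h
      obtain ⟨k', rfl, hk'⟩ := ih (β := hyperplaneReflection α β) hβ' (t := s * t * s⁻¹) (by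
        rw [Subgroup.coe_mul, Subgroup.coe_mul, ht, Subgroup.coe_inv, hsα]
        exact conj_hyperplaneReflection (norm_hyperplaneReflection α) (norm_of_mem hβ)) (by
        rwa [mul_inv_rev, Subgroup.coe_mul, LinearEquiv.mul_apply, inv_eq_of_eq hsα, hsα] at hneg)
      refine ⟨k' + 1, rfl, ?_⟩
      have e : t * (s * w) = s * (s * t * s⁻¹ * w) := by
        rw [inv_eq_of_eq hsα]
        simp only [← mul_assoc, mul_self_of_eq hsα, one_mul]
      rw [e]
      exact .cons hs hk'

/-! ### Sides of a mirror in a coset space -/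

/-- A standard parabolic subgroup preserves the positivity of the roots outside it. -/
lemma parabolic_map_mem_positiveRoots (hR : IsReflectionGroup R) (hΔ : IsSimpleSystem R b Δ)
    {S : Set R} (hS : S ⊆ simpleReflections R Δ) {h : R} (hh : h ∈ Subgroup.closure S)
    {β : Euc n} (hβ : β ∈ positiveRoots R b) {t : R} (ht : (t : GLn n) = hyperplaneReflection β)
    (htS : t ∉ Subgroup.closure S) : h.1 β ∈ positiveRoots R b := by
  have conj : ∀ (r : R) {β : Euc n} {t : R}, β ∈ positiveRoots R b →
      (t : GLn n) = hyperplaneReflection β →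
      ((r * t * r⁻¹ : R) : GLn n) = hyperplaneReflection (r.1 β) := by
    intro r β t hβ ht
    rw [Subgroup.coe_mul, Subgroup.coe_mul, ht, Subgroup.coe_inv]
    exact conj_hyperplaneReflection (isOrth_of_mem hR r.2) (norm_of_mem hβ)
  have out : ∀ {h t : R}, h ∈ Subgroup.closure S → t ∉ Subgroup.closure S →
      h * t * h⁻¹ ∉ Subgroup.closure S := fun hh ht h' => by
    have := mul_mem (mul_mem (inv_mem hh) h') hh
    exact ht (by simpa [mul_assoc] using this)
  induction hh using Subgroup.closure_induction generalizing β t with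
  | mem s hs =>
    obtain ⟨α, hα, hsα⟩ := hS hs
    rw [hsα]
    refine simple_map_mem_positiveRoots hR hΔ hα hβ ?_
    rintro rfl
    exact htS (Subtype.ext (ht.trans hsα.symm) ▸ Subgroup.subset_closure hs)
  | one => simpa using hβ
  | mul x y hx hy ihx ihy =>
    rw [Subgroup.coe_mul, LinearEquiv.mul_apply]
    exact ihx (ihy hβ ht htS) (conj y hβ ht) (out hy htS)
  | inv x hx ih =>
    -- If `x⁻¹ β` were negative, the induction hypothesis applied to `-x⁻¹ β` would make `-β`
    -- positive.
    refine (pos_or_neg_of_mem_roots (map_mem_roots hR (x⁻¹ : R).2 hβ.1)).resolve_right fun h => ?_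
    have h1 := ih h (t := x⁻¹ * t * x⁻¹⁻¹)
      ((conj x⁻¹ hβ ht).trans (hyperplaneReflection_neg _).symm) (out (inv_mem hx) htS)
    rw [map_neg, ← LinearEquiv.mul_apply, ← Subgroup.coe_mul, mul_inv_cancel] at h1
    exact neg_notMem_positiveRoots hβ (by simpa using h1)

/-- The cosets that lie strictly on the positive side of the mirror of the reflection `s` with
root `α`. -/
def PosSide (b : Module.Basis (Fin n) ℝ (Euc n)) (α : Euc n) (s : R) {H : Subgroup R}
    (v : R ⧸ H) : Prop :=
  s • v ≠ v ∧ (v.out⁻¹ : R).1 α ∈ positiveRoots R b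

section PosSide

variable {S : Set R} {α : Euc n} {s : R}

/-- The side can be read off any representative: since `s` moves the coset, `r⁻¹ s r` lies outside
`⟨S⟩`, so changing `r` within its coset keeps the sign of `r⁻¹ α`. -/
lemma posSide_mk (hR : IsReflectionGroup R) (hΔ : IsSimpleSystem R b Δ)
    (hS : S ⊆ simpleReflections R Δ) (hα : α ∈ positiveRoots R b)
    (hs : (s : GLn n) = hyperplaneReflection α) (r : R) :
    PosSide b α s (QuotientGroup.mk r : R ⧸ Subgroup.closure S) ↔
      s • (QuotientGroup.mk r : R ⧸ Subgroup.closure S) ≠ QuotientGroup.mk r ∧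
        (r⁻¹ : R).1 α ∈ positiveRoots R b := by
  refine and_congr_right fun hne => ?_
  have key : ∀ r r' : R,
      (QuotientGroup.mk r : R ⧸ Subgroup.closure S) = QuotientGroup.mk r' →
      s • (QuotientGroup.mk r : R ⧸ Subgroup.closure S) ≠ QuotientGroup.mk r →
      (r⁻¹ : R).1 α ∈ positiveRoots R b → (r'⁻¹ : R).1 α ∈ positiveRoots R b := by
    intro r r' he hne hp
    have hh : r'⁻¹ * r ∈ Subgroup.closure S := QuotientGroup.eq.1 he.symm
    have ht : ((r⁻¹ * s * r⁻¹⁻¹ : R) : GLn n) = hyperplaneReflection ((r⁻¹ : R).1 α) := by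
      rw [Subgroup.coe_mul, Subgroup.coe_mul, hs, Subgroup.coe_inv (x := r⁻¹)]
      exact conj_hyperplaneReflection (isOrth_of_mem hR (r⁻¹ : R).2) (norm_of_mem hα)
    have hout : r⁻¹ * s * r⁻¹⁻¹ ∉ Subgroup.closure S := fun h => by
      refine hne (QuotientGroup.eq.2 ?_).symm
      simpa [mul_assoc] using h
    have := parabolic_map_mem_positiveRoots hR hΔ hS hh hp ht hout
    rwa [← LinearEquiv.mul_apply, ← Subgroup.coe_mul, mul_inv_cancel_right] at this
  have hout : (QuotientGroup.mk (Quotient.out (QuotientGroup.mk r : R ⧸ Subgroup.closure S)) :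
      R ⧸ Subgroup.closure S) = QuotientGroup.mk r := QuotientGroup.out_eq' _
  exact ⟨key _ _ hout (by rwa [hout]), key _ _ hout.symm hne⟩

lemma posSide_smul_mk (hR : IsReflectionGroup R) (hΔ : IsSimpleSystem R b Δ)
    (hS : S ⊆ simpleReflections R Δ) (hα : α ∈ positiveRoots R b)
    (hs : (s : GLn n) = hyperplaneReflection α) (r : R) :
    PosSide b α s (s • (QuotientGroup.mk r : R ⧸ Subgroup.closure S)) ↔
      s • (QuotientGroup.mk r : R ⧸ Subgroup.closure S) ≠ QuotientGroup.mk r ∧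
        -((r⁻¹ : R).1 α) ∈ positiveRoots R b := by
  have e : s • (QuotientGroup.mk r : R ⧸ Subgroup.closure S) = QuotientGroup.mk (s * r) := rfl
  rw [e, posSide_mk hR hΔ hS hα hs, inv_mul_apply_root hs, ← e, smul_smul, mul_self_of_eq hs,
    one_smul, ne_comm]

lemma PosSide.not_smul (hR : IsReflectionGroup R) (hΔ : IsSimpleSystem R b Δ)
    (hS : S ⊆ simpleReflections R Δ) (hα : α ∈ positiveRoots R b)
    (hs : (s : GLn n) = hyperplaneReflection α) {v : R ⧸ Subgroup.closure S}
    (hv : PosSide b α s v) : ¬ PosSide b α s (s • v) := by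
  induction v using QuotientGroup.induction_on with
  | H r =>
    rw [posSide_mk hR hΔ hS hα hs] at hv
    rw [posSide_smul_mk hR hΔ hS hα hs]
    exact fun h => neg_notMem_positiveRoots hv.2 h.2

lemma smul_eq_of_not_posSide (hR : IsReflectionGroup R) (hΔ : IsSimpleSystem R b Δ)
    (hS : S ⊆ simpleReflections R Δ) (hα : α ∈ positiveRoots R b)
    (hs : (s : GLn n) = hyperplaneReflection α) {v : R ⧸ Subgroup.closure S}
    (hv : ¬ PosSide b α s v) (hv' : ¬ PosSide b α s (s • v)) : s • v = v := by
  induction v using QuotientGroup.induction_on with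
  | H r =>
    rw [posSide_mk hR hΔ hS hα hs] at hv
    rw [posSide_smul_mk hR hΔ hS hα hs] at hv'
    by_contra hne
    rcases pos_or_neg_of_mem_roots (b := b) (map_mem_roots hR (r⁻¹ : R).2 hα.1) with h | h
    · exact hv ⟨hne, h⟩
    · exact hv' ⟨hne, h⟩

end PosSide

/-! ### Contracting a coset space by foldings -/

/-- The simple reflections, together with their roots. -/
def SimpleRefl (R : Subgroup (GLn n)) (Δ : Set (Euc n)) : Type :=
  {q : R × Euc n // q.2 ∈ Δ ∧ (q.1 : GLn n) = hyperplaneReflection q.2}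

/-- The minimal length of a representative of a coset. -/
noncomputable def cosetLength (Δ : Set (Euc n)) {H : Subgroup R} (v : R ⧸ H) : ℕ :=
  sInf {k | ∃ r : R, QuotientGroup.mk r = v ∧ IsWord (simpleReflections R Δ) k r}

lemma cosetLength_le {H : Subgroup R} {k : ℕ} {r : R}
    (h : IsWord (simpleReflections R Δ) k r) :
    cosetLength Δ (QuotientGroup.mk r : R ⧸ H) ≤ k := Nat.sInf_le ⟨r, rfl, h⟩

lemma exists_isWord_cosetLength [Finite R] (hR : IsReflectionGroup R) (hΔ : IsSimpleSystem R b Δ)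
    {H : Subgroup R} (v : R ⧸ H) :
    ∃ r : R, QuotientGroup.mk r = v ∧ IsWord (simpleReflections R Δ) (cosetLength Δ v) r := by
  refine Nat.sInf_mem (s := {k | ∃ r : R, QuotientGroup.mk r = v ∧ _}) ?_
  obtain ⟨r, rfl⟩ := QuotientGroup.mk_surjective v
  obtain ⟨k, hk⟩ := exists_isWord hR hΔ r
  exact ⟨k, r, rfl, hk⟩

variable {S : Set R}

/-- For a shortest representative `r` of `v` the root `r⁻¹ α` is negative, so exchange writes `s r`
with one letter fewer. -/
lemma cosetLength_smul_lt [Finite R] (hR : IsReflectionGroup R) (hΔ : IsSimpleSystem R b Δ)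
    (hS : S ⊆ simpleReflections R Δ) (q : SimpleRefl R Δ) {v : R ⧸ Subgroup.closure S}
    (hv : PosSide b q.1.2 q.1.1 (q.1.1 • v)) :
    cosetLength Δ (q.1.1 • v) < cosetLength Δ v := by
  obtain ⟨⟨s, α⟩, hα, hs⟩ := q
  obtain ⟨r, rfl, hr⟩ := exists_isWord_cosetLength hR hΔ v
  rw [posSide_smul_mk hR hΔ hS (hΔ.1.1 hα) hs] at hv
  obtain ⟨k, hk, hw⟩ := hr.exchange hR hΔ (hΔ.1.1 hα) hs
    (fun h => neg_notMem_positiveRoots h hv.2)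
  rw [hk]
  exact Nat.lt_succ_of_le (cosetLength_le hw)

/-- The first letter of a shortest representative works: if it fixed `v`, or if the tail lay on the
wrong side, `v` would have a shorter representative. -/
lemma exists_posSide_smul [Finite R] (hR : IsReflectionGroup R) (hΔ : IsSimpleSystem R b Δ)
    (hS : S ⊆ simpleReflections R Δ) {v : R ⧸ Subgroup.closure S}
    (hv : v ≠ QuotientGroup.mk 1) :
    ∃ q : SimpleRefl R Δ, PosSide b q.1.2 q.1.1 (q.1.1 • v) := by
  obtain ⟨r, hrv, hr⟩ := exists_isWord_cosetLength hR hΔ v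
  generalize hk : cosetLength Δ v = k at hr
  cases hr with
  | one => exact absurd hrv.symm hv
  | @cons k s r hs hw =>
    obtain ⟨α, hα, hsα⟩ := id hs
    refine ⟨⟨(s, α), hα, hsα⟩, ?_⟩
    have e : s • v = (QuotientGroup.mk r : R ⧸ Subgroup.closure S) := by
      rw [← hrv]
      change (QuotientGroup.mk (s * (s * r)) : R ⧸ Subgroup.closure S) = _
      rw [← mul_assoc, mul_self_of_eq hsα, one_mul]
    have e' : s • (QuotientGroup.mk r : R ⧸ Subgroup.closure S) = v := hrv
    simp only
    rw [e, posSide_mk hR hΔ hS (hΔ.1.1 hα) hsα, e']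
    constructor
    · intro h
      have := cosetLength_le (H := Subgroup.closure S) hw
      rw [← h, hk] at this
      omega
    · by_contra hn
      obtain ⟨k', rfl, hw'⟩ := hw.exchange hR hΔ (hΔ.1.1 hα) hsα hn
      have := cosetLength_le (H := Subgroup.closure S) hw'
      rw [hrv, hk] at this
      omega

open Bigraph in
/-- Some sequence of foldings along simple reflections contracts `R ⧸ ⟨S⟩` to the base coset. -/
theorem exists_foldr_foldOnto_eq [Finite R] (hR : IsReflectionGroup R)
    (hΔ : IsSimpleSystem R b Δ) (hS : S ⊆ simpleReflections R Δ) :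
    ∃ L : List (SimpleRefl R Δ), ∀ v : R ⧸ Subgroup.closure S,
      L.foldr (fun q => foldOnto (MulAction.toPerm q.1.1) (PosSide b q.1.2 q.1.1)) v =
        QuotientGroup.mk 1 := by
  let φ : SimpleRefl R Δ → R ⧸ Subgroup.closure S → R ⧸ Subgroup.closure S :=
    fun q => foldOnto (MulAction.toPerm q.1.1) (PosSide b q.1.2 q.1.1)
  let F : List (SimpleRefl R Δ) → ℕ := fun L =>
    ∑ v : R ⧸ Subgroup.closure S, cosetLength Δ (L.foldr φ v)
  -- For a list of minimal total length, any image other than the base coset could be shortened by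
  -- one more fold.
  obtain ⟨L, -, hL⟩ := WellFounded.has_min (InvImage.wf F wellFounded_lt) Set.univ ⟨[], trivial⟩
  refine ⟨L, fun v => ?_⟩
  by_contra hv
  obtain ⟨q, hq⟩ := exists_posSide_smul hR hΔ hS hv
  refine hL (q :: L) trivial (show F (q :: L) < F L from
    Finset.sum_lt_sum (fun u _ => ?_) ⟨v, Finset.mem_univ _, ?_⟩)
  · simp only [List.foldr_cons]
    by_cases hu : PosSide b q.1.2 q.1.1 (q.1.1 • L.foldr φ u)
    · have e : φ q (L.foldr φ u) = q.1.1 • L.foldr φ u := if_pos hu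
      rw [e]
      exact (cosetLength_smul_lt hR hΔ hS q hu).le
    · have e : φ q (L.foldr φ u) = L.foldr φ u := if_neg hu
      rw [e]
  · simp only [List.foldr_cons]
    have e : φ q (L.foldr φ v) = q.1.1 • L.foldr φ v := if_pos hq
    rw [e]
    exact cosetLength_smul_lt hR hΔ hS q hq

open Bigraph in
/-- Every coset can be reached from the base coset by foldings along simple reflections. -/
theorem reflTransGen_fold [Finite R] (hR : IsReflectionGroup R) (hΔ : IsSimpleSystem R b Δ)
    (hS : S ⊆ simpleReflections R Δ) (v : R ⧸ Subgroup.closure S) :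
    Relation.ReflTransGen (fun u u' => ∃ q : SimpleRefl R Δ,
      u' = foldOnto (MulAction.toPerm q.1.1) (PosSide b q.1.2 q.1.1) u ∨
      u' = foldAway (MulAction.toPerm q.1.1) (PosSide b q.1.2 q.1.1) u)
      (QuotientGroup.mk 1) v := by
  obtain ⟨r, rfl⟩ := QuotientGroup.mk_surjective v
  obtain ⟨k, hk⟩ := exists_isWord hR hΔ r
  induction hk with
  | one => exact .refl
  | @cons k s r hs hw ih =>
    obtain ⟨α, hα, hsα⟩ := id hs
    set u : R ⧸ Subgroup.closure S := QuotientGroup.mk r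
    have e : (QuotientGroup.mk (s * r) : R ⧸ Subgroup.closure S) = s • u := rfl
    rw [e]
    -- Multiplication by `s` is a fold in one of the two directions unless `s` fixes `u`.
    by_cases h₁ : PosSide b α s (s • u)
    · exact ih.tail ⟨⟨(s, α), hα, hsα⟩, Or.inl (if_pos h₁).symm⟩
    by_cases h₂ : PosSide b α s u
    · exact ih.tail ⟨⟨(s, α), hα, hsα⟩, Or.inr (if_pos h₂).symm⟩
    · rwa [smul_eq_of_not_posSide hR hΔ hS (hΔ.1.1 hα) hsα h₂ h₁]

end ReflectionGroup

/-! ### Left-reflection bigraphs -/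

section LeftReflection

variable {k : ℕ}

lemma mem_edges_leftReflectionBigraph {R : Type*} [Group R] [Finite R] {S₀ : Set R}
    {S : Fin k → Set R} {v : LeftVertex S₀} {w : RightVertex S} :
    (v, w) ∈ (leftReflectionBigraph S₀ S).edges ↔
      ∃ r : R, v = QuotientGroup.mk r ∧ w.2 = QuotientGroup.mk r := by
  obtain ⟨i, w⟩ := w
  simp only [leftReflectionBigraph, Set.Finite.mem_toFinset, Set.mem_ofPred_eq, Prod.mk.injEq]
  constructor
  · rintro ⟨r, j, h, h'⟩
    obtain ⟨rfl, h'⟩ := Sigma.mk.inj_iff.1 h'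
    exact ⟨r, h, eq_of_heq h'⟩
  · rintro ⟨r, h, h'⟩
    exact ⟨r, i, h, by rw [← h']⟩

/-- Left multiplication by a group element is an automorphism of the left-reflection bigraph. -/
lemma isColorAut_smul {R : Type*} [Group R] [Finite R] (S₀ : Set R) (S : Fin k → Set R) (g : R) :
    (leftReflectionBigraph S₀ S).IsColorAut (naturalColoring S₀ S) (MulAction.toPerm g)
      (Equiv.sigmaCongrRight fun _ => MulAction.toPerm g) := by
  refine ⟨fun v w => ?_, fun v w _ _ => rfl⟩
  rw [mem_edges_leftReflectionBigraph, mem_edges_leftReflectionBigraph]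
  constructor
  · rintro ⟨r, rfl, h⟩
    exact ⟨g * r, rfl, congrArg (g • ·) h⟩
  · rintro ⟨r, h, h'⟩
    have h'' : w.2 = g⁻¹ • (QuotientGroup.mk r : R ⧸ Subgroup.closure (S w.1)) :=
      eq_inv_smul_iff.2 h'
    have h₀ : v = g⁻¹ • (QuotientGroup.mk r : R ⧸ Subgroup.closure S₀) := eq_inv_smul_iff.2 h
    exact ⟨g⁻¹ * r, h₀, h''⟩

lemma rightUniform_leftReflectionBigraph {R : Type*} [Group R] [Finite R] (S₀ : Set R)
    (S : Fin k → Set R) :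
    (leftReflectionBigraph S₀ S).RightUniform (naturalColoring S₀ S) :=
  ⟨Sigma.fst, fun _ => rfl⟩

lemma colorEdgeTransitive_leftReflectionBigraph {R : Type*} [Group R] [Finite R] (S₀ : Set R)
    (S : Fin k → Set R) :
    (leftReflectionBigraph S₀ S).ColorEdgeTransitive (naturalColoring S₀ S) := by
  rintro ⟨⟨v, i, w⟩, he⟩ ⟨⟨v', j, w'⟩, he'⟩ (rfl : i = j)
  obtain ⟨r, rfl, h⟩ := mem_edges_leftReflectionBigraph.1 he
  obtain ⟨r', rfl, h'⟩ := mem_edges_leftReflectionBigraph.1 he'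
  dsimp only at h h'
  subst h h'
  -- Both edges come from group elements, and this translation takes `r` to `r'`.
  refine ⟨_, _, isColorAut_smul S₀ S (r' * r⁻¹), ?_, ?_⟩
  · exact congrArg QuotientGroup.mk (inv_mul_cancel_right r' r)
  · exact congrArg (fun x : R => (⟨i, QuotientGroup.mk x⟩ : RightVertex S))
      (inv_mul_cancel_right r' r)

open ReflectionGroup

/-- Simple reflections fold left-reflection bigraphs. -/
lemma isFold_leftReflectionBigraph {n : ℕ} {R : Subgroup (GLn n)} [Finite R]
    (hR : IsReflectionGroup R) {b : Module.Basis (Fin n) ℝ (Euc n)} {Δ : Set (Euc n)}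
    (hΔ : IsSimpleSystem R b Δ) {S₀ : Set R} {S : Fin k → Set R}
    (hS₀ : S₀ ⊆ simpleReflections R Δ) (hS : ∀ i, S i ⊆ simpleReflections R Δ)
    (q : SimpleRefl R Δ) :
    (leftReflectionBigraph S₀ S).IsFold (naturalColoring S₀ S) (MulAction.toPerm q.1.1)
      (Equiv.sigmaCongrRight fun _ => MulAction.toPerm q.1.1)
      (PosSide b q.1.2 q.1.1) (fun w => PosSide b q.1.2 q.1.1 w.2) := by
  obtain ⟨⟨s, α⟩, hα, hs⟩ := q
  have hαp := hΔ.1.1 hα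
  have hss : ∀ {H : Subgroup R} (v : R ⧸ H), s • s • v = v := fun v => by
    rw [smul_smul, mul_self_of_eq hs, one_smul]
  refine ⟨isColorAut_smul S₀ S s, fun v => hss v, fun ⟨i, w⟩ => congrArg (Sigma.mk i) (hss w),
    fun v hv => hv.not_smul hR hΔ hS₀ hαp hs, fun w hw => hw.not_smul hR hΔ (hS w.1) hαp hs,
    fun v h h' => smul_eq_of_not_posSide hR hΔ hS₀ hαp hs h h',
    fun ⟨i, w⟩ h h' => congrArg (Sigma.mk i) (smul_eq_of_not_posSide hR hΔ (hS i) hαp hs h h'),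
    ?_⟩
  rintro v ⟨i, w⟩ he hv hw
  obtain ⟨r, rfl, h⟩ := mem_edges_leftReflectionBigraph.1 he
  dsimp only at h
  subst h
  -- With the common representative `r`, ends on opposite sides would make both `r⁻¹ α` and its
  -- negative positive.
  have h₁ := ((posSide_mk hR hΔ hS₀ hαp hs r).1 hv).2
  have h₂ := ((posSide_smul_mk hR hΔ (hS i) hαp hs r).1 hw).2
  exact neg_notMem_positiveRoots h₁ h₂

end LeftReflection

theorem mainTheorem6 (n : ℕ)
    (R : Subgroup (ReflectionGroup.GLn n)) [Finite R]
    (hR : ReflectionGroup.IsReflectionGroup R)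
    (b : Module.Basis (Fin n) ℝ (ReflectionGroup.Euc n))
    (Δ : Set (ReflectionGroup.Euc n)) (hΔ : ReflectionGroup.IsSimpleSystem R b Δ)
    (k : ℕ) (S₀ : Set R) (S : Fin k → Set R)
    (hS₀ : S₀ ⊆ ReflectionGroup.simpleReflections R Δ)
    (hS : ∀ i, S i ⊆ ReflectionGroup.simpleReflections R Δ) :
    (leftReflectionBigraph S₀ S).RightUniform (naturalColoring S₀ S) ∧
    (leftReflectionBigraph S₀ S).ColorEdgeTransitive (naturalColoring S₀ S) ∧
    Bigraph.LeftWeaklyHolder.{0, 0, 0, u, x, y}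
      (leftReflectionBigraph S₀ S) (naturalColoring S₀ S) := by
  obtain ⟨L, hL⟩ := ReflectionGroup.exists_foldr_foldOnto_eq hR hΔ hS₀
  exact ⟨rightUniform_leftReflectionBigraph S₀ S, colorEdgeTransitive_leftReflectionBigraph S₀ S,
    Bigraph.leftWeaklyHolder_of_folds _ _ _ _
      (isFold_leftReflectionBigraph (k := k) hR hΔ hS₀ hS) _ L hL
      (ReflectionGroup.reflTransGen_fold hR hΔ hS₀)⟩
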